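/- Let $n>1$ be an integer, $\varepsilon>0$ and $c\in\mathbb{R}$. Let $0<R\le\infty$ and let $\lambda$ be a real function which on $(-R,R)$ is the sum of its Maclaurin series (a function that is real analytic on $[0,1]$, in the sense that its Maclaurin series represents it on a neighbourhood of $[0,1]$, is the case $R>1$). For $l\in\mathbb{N}=\{0,1,2,\dots\}$ and $\delta>0$ let $\mathcal{T}_\delta=\{(r,\rho):0\le\rho\le r\le\delta\}$. A family of real coefficients $(C_{jk})_{j,k\ge 0}$ is called a power series solution of the kernel equations on $\mathcal{T}_\delta$ if the double series $$G(r,\rho)=\sum_{j,k\ge 0}C_{jk}\,r^{j}\rho^{k}$$ converges absolutely at every point of $\mathcal{T}_\delta$ and its sum satisfies $$\frac{\lambda(\rho)+c}{\varepsilon}\,G=\partial_{rr}G+(3-n-2l)\frac{\partial_rG}{r}-\partial_{\rho\rho}G+(1-n-2l)\frac{\partial_\rho G}{\rho}\qquad(0<\rho<r<\delta),$$ $$G(r,r)=-\frac{1}{2r\varepsilon}\int_0^r(\lambda(\sigma)+c)\,d\sigma\qquad(0<r\le\delta).$$ (1) Suppose that $\lambda$ is even on $(-R,R)$. Then for every $l\in\mathbb{N}$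 there is a family $(C_{jk})$ which is a power series solution on $\mathcal{T}_\delta$ for every $0<\delta<R$ (in particular, if $R>1$, on the triangle $0\le\rho\le r\le 1$). Its sum $G$ is real analytic on (a neighbourhood of each point of) $\mathcal{T}_\delta$ and is even in each of the two variables: $G(-r,\rho)=G(r,\rho)=G(r,-\rho)$ for $|r|,|\rho|\le\delta$. It is unique: for every $\delta>0$, every power series solution on $\mathcal{T}_\delta$ has the same coefficients $(C_{jk})$. (2) Suppose that $\lambda$ is not even on $(-R,R)$. Then for all but finitely many $l\in\mathbb{N}$ there is no $\delta>0$ for which a power series solution on $\mathcal{T}_\delta$ exists. -/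

import Mathlib

open Filter

noncomputable section

/-- The sum of the double power series `∑ C j k r^j ρ^k` in the two variables `r, ρ`.
Collecting the terms of total degree `i = j + k` gives `∑ᵢ ∑_{j ≤ i} C_{j,i-j} r^j ρ^(i-j)`. -/
def kernelSum (C : ℕ → ℕ → ℝ) (r ρ : ℝ) : ℝ :=
  ∑' q : ℕ × ℕ, C q.1 q.2 * r ^ q.1 * ρ ^ q.2

/-- The closed triangle `0 ≤ ρ ≤ r ≤ δ`, with points written `(r, ρ)`. -/
def kernelTriangle (δ : ℝ) : Set (ℝ × ℝ) :=
  {x | 0 ≤ x.2 ∧ x.2 ≤ x.1 ∧ x.1 ≤ δ}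

/-- The singular kernel equation at the point `(r, ρ)`:
`(λ(ρ)+c)/ε G = ∂_rr G + (3-n-2l) ∂_r G / r - ∂_ρρ G + (1-n-2l) ∂_ρ G / ρ`. -/
def KernelPDEAt (n l : ℕ) (ε c : ℝ) (lam : ℝ → ℝ) (G : ℝ → ℝ → ℝ) (r ρ : ℝ) : Prop :=
  (lam ρ + c) / ε * G r ρ =
    iteratedDeriv 2 (fun s => G s ρ) r
      + (3 - (n : ℝ) - 2 * (l : ℝ)) * (deriv (fun s => G s ρ) r / r)
      - iteratedDeriv 2 (fun s => G r s) ρ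
      + (1 - (n : ℝ) - 2 * (l : ℝ)) * (deriv (fun s => G r s) ρ / ρ)

/-- The boundary condition on the diagonal:
`G(r,r) = - (∫₀ʳ (λ(σ)+c) dσ) / (2 r ε)`. -/
def KernelBCAt (ε c : ℝ) (lam : ℝ → ℝ) (G : ℝ → ℝ → ℝ) (r : ℝ) : Prop :=
  G r r = -((∫ σ in (0 : ℝ)..r, (lam σ + c)) / (2 * r * ε))

/-- The coefficients `C` define a power series solution of the kernel equations on the triangle
`0 ≤ ρ ≤ r ≤ δ`: the double series converges at every point of the triangle, its sum satisfies
the differential equation in the interior, and the boundary condition on the diagonal. -/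
structure IsPowerSeriesSolution (n l : ℕ) (ε c : ℝ) (lam : ℝ → ℝ) (δ : ℝ)
    (C : ℕ → ℕ → ℝ) : Prop where
  summable : ∀ x ∈ kernelTriangle δ,
    Summable fun q : ℕ × ℕ => C q.1 q.2 * x.1 ^ q.1 * x.2 ^ q.2
  pde : ∀ r ρ : ℝ, 0 < ρ → ρ < r → r < δ → KernelPDEAt n l ε c lam (kernelSum C) r ρ
  bc : ∀ r : ℝ, 0 < r → r ≤ δ → KernelBCAt ε c lam (kernelSum C) r

/-- `f` is even on the interval `(-R, R)`. -/
def IsEvenWithin (R : ENNReal) (f : ℝ → ℝ) : Prop :=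
  ∀ r : ℝ, ENNReal.ofReal |r| < R → f (-r) = f r

end

/-!
Write `N = n + 2l`, `ν = N / 2`, and let `μ m` be the Maclaurin coefficients of `(λ + c) / ε`.
Multiplied by `r² ρ²`, the kernel equation contains the derivatives only through the Euler operators
`r ∂_r` and `ρ ∂_ρ`, which act diagonally on monomials. Hence (`kernelPDEAt_iff`,
`eq_zero_of_kernelSum_eq_zero`, `kernelResidual_eq_zero_iff`) it is equivalent to
`(j+2)(j+4-N) C_{j+2,k} - (k+2)(k+N) C_{j,k+2} = ∑_{m ≤ k} μ_m C_{j,k-m}` together with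
`(3-N) C_{1,k} = 0` and `(N-1) C_{j,1} = 0`, and the boundary condition says that
`∑_{j+k=i} C_{j,k} = -μ_i / (2(i+1))`. The system is triangular in the total degree `i = j + k`.

*Uniqueness.* In one degree the homogeneous system leaves only the multiples of one polynomial
`∑ w_s r^(i-2s) ρ^(2s)`. In even degree its value at `(1, 1)` is nonzero by the Chu–Vandermonde
identity (`sum_homWeight_ne_zero`). In odd degree either all weights are nonnegative (if the recursion
meets the resonance `j = N - 2`), or the polynomial contains `r ρ^(i-1)`, which is not allowed
(`homogeneous_eq_zero`).

*Nonexistence.* If `λ` is not even, let `i` be the first odd index with `μ_i ≠ 0`. For `N > i + 2` no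
resonance is met, so all terms of odd degree at most `i` vanish, against the boundary condition in
degree `i` (`IsFormalSolution.odd_coeff_eq_zero`).

*Existence.* For even `λ` the degrees `2d` can be solved one after another. Convergence on the full
range of `λ` needs a bound that gains over the mere solvability: the recursion in degree `2d` is stable
towards larger powers of `ρ` beyond the pivot `2s = d - ν` and stable towards smaller powers before
it, and on the stable sides the coefficients are at least of order `d²`. So the `ℓ¹` norm `M_d` of the
coefficients of degree `2d` satisfies `M_d ≤ 2 |b_d| + (96 / d) ∑ |h_s|`
(`sum_abs_le_of_degree_solution`), where `b_d` is the prescribed sum and `h` the source coming from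
lower degrees. The factor `1 / d` makes the convolution with `μ` a contraction in high degree, so that
`∑ M_d x^d` converges wherever `∑ |μ_{2m}| x^m` does (`summable_of_convolution_bound`).
-/

open Finset.HasAntidiagonal (antidiagonal mem_antidiagonal)

/-! ### One-variable power series and sums over antidiagonals -/

theorem HasSum.of_eq {ι : Type*} {f g : ι → ℝ} {s t : ℝ} (h : HasSum f s) (hfg : ∀ i, f i = g i)
    (hst : s = t) : HasSum g t := by
  rwa [funext hfg, hst] at h

theorem hasSum_sum_antidiagonal {f : ℕ × ℕ → ℝ} (hf : Summable f) :
    HasSum (fun i => ∑ q ∈ antidiagonal i, f q) (∑' q, f q) := by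
  have h : HasSum (f ∘ Finset.HasAntidiagonal.sigmaAntidiagonalEquivProd) (∑' q, f q) :=
    (Finset.HasAntidiagonal.sigmaAntidiagonalEquivProd (A := ℕ)).hasSum_iff.mpr hf.hasSum
  refine h.sigma fun i => ?_
  have := hasSum_fintype (fun q : antidiagonal i => f q)
  rw [Finset.sum_coe_sort (antidiagonal i) f] at this
  exact this

theorem coeff_zero_eq_zero_of_hasSum_zero {c : ℕ → ℝ} {a : ℝ} (ha : 0 < a)
    (h : ∀ x, 0 < x → x < a → HasSum (fun m => c m * x ^ m) 0) : c 0 = 0 := by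
  set b := a / 2 with hb
  have hb0 : 0 < b := by positivity
  have hs : Summable fun m => |c (m + 1)| * b ^ m := by
    have h1 := ((summable_nat_add_iff 1).mpr (h b hb0 (by linarith)).summable).abs
    refine (h1.mul_left b⁻¹).congr fun m => ?_
    rw [abs_mul, abs_of_pos (pow_pos hb0 _), pow_succ]
    field_simp
  set K := ∑' m, |c (m + 1)| * b ^ m
  have hK : 0 ≤ K := tsum_nonneg fun m => by positivity
  -- on `(0, b)` the constant term equals minus the rest, which is at most `x * K`
  have key : ∀ x, 0 < x → x < b → |c 0| ≤ x * K := by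
    intro x hx hxb
    have hsx := h x hx (by linarith)
    have h0 := hsx.summable.tsum_eq_zero_add
    rw [hsx.tsum_eq] at h0
    simp only [pow_zero, mul_one] at h0
    have hc : c 0 = -∑' m, c (m + 1) * x ^ (m + 1) := by linarith
    rw [hc, abs_neg, ← Real.norm_eq_abs]
    refine tsum_of_norm_bounded (hs.hasSum.mul_left x) fun m => ?_
    rw [Real.norm_eq_abs, abs_mul, abs_of_pos (pow_pos hx _), pow_succ]
    have : x ^ m ≤ b ^ m := by gcongr
    calc |c (m + 1)| * (x ^ m * x) = x * (|c (m + 1)| * x ^ m) := by ring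
      _ ≤ _ := by gcongr
  by_contra hne
  have hpos : 0 < |c 0| := abs_pos.mpr hne
  set x := min (b / 2) (|c 0| / (2 * (K + 1)))
  have hx : 0 < x := by positivity
  have h1 := key x hx (lt_of_le_of_lt (min_le_left _ _) (by linarith))
  have h2 : x * K ≤ |c 0| / (2 * (K + 1)) * K := by gcongr; exact min_le_right _ _
  have h3 : |c 0| / (2 * (K + 1)) * K < |c 0| := by
    rw [div_mul_eq_mul_div, div_lt_iff₀ (by positivity)]
    nlinarith
  linarith

/-- Identity theorem in one variable, for a one-sided interval. -/
theorem coeff_eq_zero_of_hasSum_zero {a : ℝ} (ha : 0 < a) (m : ℕ) {c : ℕ → ℝ}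
    (h : ∀ x, 0 < x → x < a → HasSum (fun m => c m * x ^ m) 0) : c m = 0 := by
  induction m generalizing c with
  | zero => exact coeff_zero_eq_zero_of_hasSum_zero ha h
  | succ m ih =>
    have h0 := coeff_zero_eq_zero_of_hasSum_zero ha h
    refine @ih (fun m => c (m + 1)) fun x hx hxa => ?_
    have h1 := (hasSum_nat_add_iff' 1).mpr (h x hx hxa)
    simp only [Finset.range_one, Finset.sum_singleton, h0, zero_mul, sub_zero] at h1
    have h2 := h1.mul_left x⁻¹
    rw [mul_zero] at h2
    refine h2.of_eq (fun m => ?_) rfl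
    rw [pow_succ]
    field_simp

/-! ### Absolutely convergent double power series -/

/-- The double series `∑ D j k r^j ρ^k` converges absolutely at `r = ρ = a`
(the notion is used for `0 ≤ a` only). -/
def AbsConv (D : ℕ → ℕ → ℝ) (a : ℝ) : Prop :=
  Summable fun q : ℕ × ℕ => |D q.1 q.2| * a ^ q.1 * a ^ q.2

theorem abs_term_le {D : ℕ → ℕ → ℝ} {a r ρ : ℝ} (hr : |r| ≤ a) (hρ : |ρ| ≤ a) (q : ℕ × ℕ) :
    ‖D q.1 q.2 * r ^ q.1 * ρ ^ q.2‖ ≤ |D q.1 q.2| * a ^ q.1 * a ^ q.2 := by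
  have ha : 0 ≤ a := (abs_nonneg r).trans hr
  rw [Real.norm_eq_abs, abs_mul, abs_mul, abs_pow, abs_pow]
  gcongr

theorem AbsConv.summable {D : ℕ → ℕ → ℝ} {a r ρ : ℝ} (h : AbsConv D a) (hr : |r| ≤ a)
    (hρ : |ρ| ≤ a) : Summable fun q : ℕ × ℕ => D q.1 q.2 * r ^ q.1 * ρ ^ q.2 :=
  Summable.of_norm_bounded h (abs_term_le hr hρ)

theorem AbsConv.hasSum {D : ℕ → ℕ → ℝ} {a r ρ : ℝ} (h : AbsConv D a) (hr : |r| ≤ a)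
    (hρ : |ρ| ≤ a) :
    HasSum (fun q : ℕ × ℕ => D q.1 q.2 * r ^ q.1 * ρ ^ q.2) (kernelSum D r ρ) :=
  (h.summable hr hρ).hasSum

theorem absConv_of_summable {D : ℕ → ℕ → ℝ} {a : ℝ} (ha : 0 ≤ a)
    (h : Summable fun q : ℕ × ℕ => D q.1 q.2 * a ^ q.1 * a ^ q.2) : AbsConv D a := by
  refine h.abs.congr fun q => ?_
  rw [abs_mul, abs_mul, abs_of_nonneg (pow_nonneg ha _), abs_of_nonneg (pow_nonneg ha _)]

theorem AbsConv.anti {D : ℕ → ℕ → ℝ} {a b : ℝ} (h : AbsConv D a) (hb : 0 ≤ b) (hba : b ≤ a) :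
    AbsConv D b :=
  Summable.of_nonneg_of_le (fun q => by positivity)
    (fun q => by have := hb.trans hba; gcongr) h

theorem AbsConv.sub {D E : ℕ → ℕ → ℝ} {a : ℝ} (hD : AbsConv D a) (hE : AbsConv E a)
    (ha : 0 ≤ a) : AbsConv (fun j k => D j k - E j k) a := by
  refine Summable.of_nonneg_of_le (fun q => by positivity) (fun q => ?_) (Summable.add hD hE)
  have := abs_sub (D q.1 q.2) (E q.1 q.2)
  rw [← add_mul, ← add_mul]
  gcongr

theorem kernelSum_sub {D E : ℕ → ℕ → ℝ} {a r ρ : ℝ} (hD : AbsConv D a) (hE : AbsConv E a)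
    (hr : |r| ≤ a) (hρ : |ρ| ≤ a) :
    kernelSum (fun j k => D j k - E j k) r ρ = kernelSum D r ρ - kernelSum E r ρ := by
  rw [kernelSum, kernelSum, kernelSum, ← (hD.summable hr hρ).tsum_sub (hE.summable hr hρ)]
  exact tsum_congr fun q => by ring

theorem AbsConv.swap {D : ℕ → ℕ → ℝ} {a : ℝ} (h : AbsConv D a) :
    AbsConv (fun j k => D k j) a := by
  refine ((Equiv.prodComm ℕ ℕ).summable_iff.mpr h).congr fun q => ?_
  simp only [Function.comp, Equiv.prodComm_apply, Prod.fst_swap, Prod.snd_swap]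
  ring

theorem kernelSum_swap (D : ℕ → ℕ → ℝ) (r ρ : ℝ) :
    kernelSum (fun j k => D k j) ρ r = kernelSum D r ρ := by
  rw [kernelSum, kernelSum, ← (Equiv.prodComm ℕ ℕ).tsum_eq]
  refine tsum_congr fun q => ?_
  simp only [Equiv.prodComm_apply, Prod.fst_swap, Prod.snd_swap]
  ring

theorem exists_sq_mul_pow_le {a b : ℝ} (hb : 0 ≤ b) (hba : b < a) :
    ∃ M, 0 ≤ M ∧ ∀ n : ℕ, ((n : ℝ) + 1) ^ 2 * b ^ n ≤ M * a ^ n := by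
  have ha : 0 < a := hb.trans_lt hba
  have hq : |b / a| < 1 := by
    rw [abs_of_nonneg (by positivity), div_lt_one ha]; exact hba
  have ht := tendsto_pow_const_mul_const_pow_of_abs_lt_one 2 hq
  obtain ⟨M, hM⟩ := ht.bddAbove_range
  have hM' : ∀ n : ℕ, (n : ℝ) ^ 2 * (b / a) ^ n ≤ M := fun n => hM ⟨n, rfl⟩
  have hM0 : 0 ≤ M := by simpa using hM' 0
  refine ⟨2 * M + 2, by linarith, fun n => ?_⟩
  have h1 : (b / a) ^ n ≤ 1 := pow_le_one₀ (by positivity) ((abs_of_nonneg (by positivity :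
    (0 : ℝ) ≤ b / a)) ▸ hq.le)
  have h2 : b ^ n = (b / a) ^ n * a ^ n := by rw [div_pow]; field_simp
  rw [h2, ← mul_assoc]
  gcongr
  have h3 : ((n : ℝ) + 1) ^ 2 ≤ 2 * n ^ 2 + 2 := by nlinarith [sq_nonneg ((n : ℝ) - 1)]
  have h4 : 0 ≤ (b / a) ^ n := by positivity
  have := hM' n
  nlinarith

/-- Quadratic weights in the exponents do not affect absolute convergence at smaller radii. -/
theorem AbsConv.weight {D w : ℕ → ℕ → ℝ} {a b K : ℝ} (h : AbsConv D a) (hb : 0 ≤ b)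
    (hba : b < a) (hw : ∀ j k, |w j k| ≤ K * ((j : ℝ) + k + 1) ^ 2) :
    AbsConv (fun j k => w j k * D j k) b := by
  obtain ⟨M, hM0, hM⟩ := exists_sq_mul_pow_le hb hba
  have hK : 0 ≤ K := by simpa using (abs_nonneg _).trans (hw 0 0)
  refine Summable.of_nonneg_of_le (fun q => by positivity) (fun q => ?_)
    (Summable.mul_left (K * M) h)
  have h1 := hM (q.1 + q.2)
  push_cast at h1
  rw [pow_add, pow_add] at h1
  calc |w q.1 q.2 * D q.1 q.2| * b ^ q.1 * b ^ q.2
      = |w q.1 q.2| * (|D q.1 q.2| * (b ^ q.1 * b ^ q.2)) := by rw [abs_mul]; ring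
    _ ≤ (K * ((q.1 : ℝ) + q.2 + 1) ^ 2) * (|D q.1 q.2| * (b ^ q.1 * b ^ q.2)) := by
        gcongr; exact hw _ _
    _ = K * |D q.1 q.2| * (((q.1 : ℝ) + q.2 + 1) ^ 2 * (b ^ q.1 * b ^ q.2)) := by ring
    _ ≤ K * |D q.1 q.2| * (M * (a ^ q.1 * a ^ q.2)) := by gcongr
    _ = _ := by ring

theorem AbsConv.euler {D : ℕ → ℕ → ℝ} {a b : ℝ} (h : AbsConv D a) (hb : 0 ≤ b) (hba : b < a) :
    AbsConv (fun j k => (j : ℝ) * D j k) b := by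
  refine h.weight (w := fun j _ => (j : ℝ)) (K := 1) hb hba fun j k => ?_
  rw [abs_of_nonneg (by positivity)]
  have : (0 : ℝ) ≤ j := by positivity
  have : (0 : ℝ) ≤ k := by positivity
  nlinarith

/-- The Euler operator `r ∂_r` multiplies the coefficient of `r^j ρ^k` by `j`. -/
theorem AbsConv.hasDerivAt_fst {D : ℕ → ℕ → ℝ} {a r ρ : ℝ} (h : AbsConv D a) (hr0 : r ≠ 0)
    (hr : |r| < a) (hρ : |ρ| < a) :
    HasDerivAt (fun s => kernelSum D s ρ) (kernelSum (fun j k => (j : ℝ) * D j k) r ρ / r) r := by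
  obtain ⟨b, hb1, hba⟩ := exists_between (max_lt hr hρ)
  have hrb : |r| < b := (le_max_left _ _).trans_lt hb1
  have hρb : |ρ| < b := (le_max_right _ _).trans_lt hb1
  have hb : 0 < b := (abs_nonneg r).trans_lt hrb
  have hE := h.euler hb.le hba
  have key := hasDerivAt_tsum_of_isPreconnected
    (g := fun (q : ℕ × ℕ) s => D q.1 q.2 * s ^ q.1 * ρ ^ q.2)
    (g' := fun (q : ℕ × ℕ) s => D q.1 q.2 * ((q.1 : ℝ) * s ^ (q.1 - 1)) * ρ ^ q.2)
    (u := fun q => b⁻¹ * (|(q.1 : ℝ) * D q.1 q.2| * b ^ q.1 * b ^ q.2))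
    (t := Metric.ball (0 : ℝ) b) (y₀ := r) (y := r) (Summable.mul_left _ hE)
    Metric.isOpen_ball (convex_ball _ _).isPreconnected
    (fun q s _ => ((hasDerivAt_pow q.1 s).const_mul _).mul_const _)
    (fun q s hs => by
      have hs' : |s| ≤ b := by simpa using (mem_ball_zero_iff.mp hs).le
      rcases q with ⟨_ | j, k⟩
      · simp
      · rw [Real.norm_eq_abs]
        simp only [abs_mul, abs_pow, Nat.add_sub_cancel, Nat.abs_cast]
        calc |D (j + 1) k| * (((j + 1 : ℕ) : ℝ) * |s| ^ j) * |ρ| ^ k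
            ≤ |D (j + 1) k| * (((j + 1 : ℕ) : ℝ) * b ^ j) * b ^ k := by gcongr
          _ = _ := by rw [pow_succ]; field_simp)
    (by simpa using hrb) (h.summable hr.le hρ.le) (by simpa using hrb)
  refine key.congr_deriv ?_
  rw [kernelSum, ← tsum_div_const]
  refine tsum_congr fun q => ?_
  rcases q with ⟨_ | j, k⟩
  · simp
  · simp only [Nat.add_sub_cancel, pow_succ]
    field_simp

/-- `r² ∂_rr` multiplies the coefficient of `r^j ρ^k` by `j (j - 1)`. -/
theorem AbsConv.sq_mul_iteratedDeriv_fst {D : ℕ → ℕ → ℝ} {a r ρ : ℝ} (h : AbsConv D a)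
    (hr0 : r ≠ 0) (hr : |r| < a) (hρ : |ρ| < a) :
    r ^ 2 * iteratedDeriv 2 (fun s => kernelSum D s ρ) r =
      kernelSum (fun j k => (j : ℝ) * (j * D j k)) r ρ
        - kernelSum (fun j k => (j : ℝ) * D j k) r ρ := by
  obtain ⟨b, hb1, hba⟩ := exists_between (max_lt hr hρ)
  have hrb : |r| < b := (le_max_left _ _).trans_lt hb1
  have hρb : |ρ| < b := (le_max_right _ _).trans_lt hb1
  have hb : 0 < b := (abs_nonneg r).trans_lt hrb
  have hE := h.euler hb.le hba
  have hev : deriv (fun s => kernelSum D s ρ) =ᶠ[nhds r]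
      fun s => kernelSum (fun j k => (j : ℝ) * D j k) s ρ / s := by
    have h1 : ∀ᶠ s in nhds r, s ≠ 0 := isOpen_ne.mem_nhds hr0
    have h2 : ∀ᶠ s in nhds r, |s| < a :=
      (isOpen_lt continuous_abs continuous_const).mem_nhds hr
    filter_upwards [h1, h2] with s hs0 hs
    exact (h.hasDerivAt_fst hs0 hs hρ).deriv
  rw [iteratedDeriv_succ, iteratedDeriv_one, hev.deriv_eq,
    ((hE.hasDerivAt_fst hr0 hrb hρb).fun_div (hasDerivAt_id' r) hr0).deriv]
  field_simp

theorem AbsConv.mul_deriv_fst {D : ℕ → ℕ → ℝ} {a r ρ : ℝ} (h : AbsConv D a)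
    (hr0 : r ≠ 0) (hr : |r| < a) (hρ : |ρ| < a) :
    r ^ 2 * (deriv (fun s => kernelSum D s ρ) r / r) =
      kernelSum (fun j k => (j : ℝ) * D j k) r ρ := by
  rw [(h.hasDerivAt_fst hr0 hr hρ).deriv]
  field_simp

/-- The coefficients of `r^i ρ^k` times a double power series. -/
def shiftCoeff (i k : ℕ) (D : ℕ → ℕ → ℝ) : ℕ → ℕ → ℝ := fun j' k' =>
  if i ≤ j' ∧ k ≤ k' then D (j' - i) (k' - k) else 0

theorem hasSum_shiftCoeff (i k : ℕ) {D : ℕ → ℕ → ℝ} {r ρ s : ℝ}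
    (h : HasSum (fun q : ℕ × ℕ => D q.1 q.2 * r ^ q.1 * ρ ^ q.2) s) :
    HasSum (fun q : ℕ × ℕ => shiftCoeff i k D q.1 q.2 * r ^ q.1 * ρ ^ q.2)
      (r ^ i * ρ ^ k * s) := by
  have hinj : Function.Injective fun q : ℕ × ℕ => (q.1 + i, q.2 + k) := by
    rintro ⟨a, b⟩ ⟨c, d⟩ h
    simp only [Prod.mk.injEq, Nat.add_right_cancel_iff] at h
    simp [h]
  rw [← hinj.hasSum_iff]
  · refine (h.mul_left (r ^ i * ρ ^ k)).of_eq (fun q => ?_) rfl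
    simp only [Function.comp, shiftCoeff, Nat.le_add_left, and_self, if_true,
      Nat.add_sub_cancel, pow_add]
    ring
  · intro q hq
    have : ¬ (i ≤ q.1 ∧ k ≤ q.2) := fun hc =>
      hq ⟨(q.1 - i, q.2 - k), by simp [Nat.sub_add_cancel hc.1, Nat.sub_add_cancel hc.2]⟩
    simp [shiftCoeff, this]

theorem AbsConv.shiftCoeff {D : ℕ → ℕ → ℝ} {a : ℝ} (h : AbsConv D a) (ha : 0 ≤ a) (i k : ℕ) :
    AbsConv (shiftCoeff i k D) a := by
  refine absConv_of_summable ha (hasSum_shiftCoeff i k (h.hasSum ?_ ?_)).summable <;>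
    simp [abs_of_nonneg ha]

theorem kernelSum_shiftCoeff (i k : ℕ) {D : ℕ → ℕ → ℝ} {a r ρ : ℝ} (h : AbsConv D a)
    (hr : |r| ≤ a) (hρ : |ρ| ≤ a) :
    kernelSum (shiftCoeff i k D) r ρ = r ^ i * ρ ^ k * kernelSum D r ρ :=
  (hasSum_shiftCoeff i k (h.hasSum hr hρ)).tsum_eq

/-- The coefficients of `(∑ μ m ρ^m) * ∑ D j k r^j ρ^k`. -/
def convCoeff (μ : ℕ → ℝ) (D : ℕ → ℕ → ℝ) (j k : ℕ) : ℝ :=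
  ∑ q ∈ antidiagonal k, μ q.1 * D j q.2

theorem AbsConv.row {D : ℕ → ℕ → ℝ} {a : ℝ} (h : AbsConv D a) (ha : 0 < a) (j : ℕ) :
    Summable fun k => |D j k| * a ^ k := by
  have := (h.prod_factor j).mul_left ((a ^ j)⁻¹)
  refine this.congr fun k => ?_
  simp only
  field_simp

theorem AbsConv.convCoeff {D : ℕ → ℕ → ℝ} {μ : ℕ → ℝ} {a : ℝ} (h : AbsConv D a) (ha : 0 < a)
    (hμ : Summable fun m => |μ m| * a ^ m) : AbsConv (convCoeff μ D) a := by
  have hμ' : Summable fun m => ‖|μ m| * a ^ m‖ := hμ.norm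
  have hD' : ∀ j, Summable fun k => ‖|D j k| * a ^ k‖ := fun j => (h.row ha j).norm
  have hle : ∀ j k, |_root_.convCoeff μ D j k| * a ^ k ≤
      ∑ q ∈ antidiagonal k, (|μ q.1| * a ^ q.1) * (|D j q.2| * a ^ q.2) := by
    intro j k
    calc |_root_.convCoeff μ D j k| * a ^ k
        ≤ (∑ q ∈ antidiagonal k, |μ q.1 * D j q.2|) * a ^ k := by
          gcongr; exact Finset.abs_sum_le_sum_abs _ _
      _ = _ := by
          rw [Finset.sum_mul]
          refine Finset.sum_congr rfl fun q hq => ?_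
          rw [← mem_antidiagonal.mp hq, abs_mul, pow_add]
          ring
  have hsum : ∀ j, Summable fun k =>
      ∑ q ∈ antidiagonal k, (|μ q.1| * a ^ q.1) * (|D j q.2| * a ^ q.2) := fun j =>
    (summable_norm_sum_mul_antidiagonal_of_summable_norm hμ' (hD' j)).of_norm
  have hrow : ∀ j, Summable fun k => |_root_.convCoeff μ D j k| * a ^ k := fun j =>
    Summable.of_nonneg_of_le (fun k => by positivity) (hle j) (hsum j)
  have hcols := ((summable_prod_of_nonneg (f := fun q : ℕ × ℕ => |D q.1 q.2| * a ^ q.1 * a ^ q.2)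
    (fun q => by positivity)).mp h).2
  refine (summable_prod_of_nonneg fun q => by positivity).mpr ⟨fun j => ?_, ?_⟩
  · exact ((hrow j).mul_left (a ^ j)).congr fun k => by ring
  · refine Summable.of_nonneg_of_le (fun j => tsum_nonneg fun k => by positivity) (fun j => ?_)
      (hcols.mul_left (∑' m, |μ m| * a ^ m))
    have h1 : ∑' k, |D j k| * a ^ j * a ^ k = a ^ j * ∑' k, |D j k| * a ^ k := by
      rw [← tsum_mul_left]; exact tsum_congr fun k => by ring
    have h2 : ∑' k, |_root_.convCoeff μ D j k| * a ^ j * a ^ k =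
        a ^ j * ∑' k, |_root_.convCoeff μ D j k| * a ^ k := by
      rw [← tsum_mul_left]; exact tsum_congr fun k => by ring
    have h3 : ∑' k, |_root_.convCoeff μ D j k| * a ^ k ≤
        (∑' m, |μ m| * a ^ m) * ∑' k, |D j k| * a ^ k := by
      rw [tsum_mul_tsum_eq_tsum_sum_antidiagonal_of_summable_norm hμ' (hD' j)]
      exact (hrow j).tsum_le_tsum (hle j) (hsum j)
    simp only [h1, h2]
    calc _ ≤ a ^ j * ((∑' m, |μ m| * a ^ m) * ∑' k, |D j k| * a ^ k) := by gcongr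
      _ = _ := by ring

theorem kernelSum_convCoeff {D : ℕ → ℕ → ℝ} {μ : ℕ → ℝ} {a r ρ : ℝ} (h : AbsConv D a)
    (ha : 0 < a) (hμ : Summable fun m => |μ m| * a ^ m) (hr : |r| ≤ a) (hρ : |ρ| ≤ a) :
    kernelSum (convCoeff μ D) r ρ = (∑' m, μ m * ρ ^ m) * kernelSum D r ρ := by
  have hμρ : Summable fun m => ‖μ m * ρ ^ m‖ :=
    Summable.of_nonneg_of_le (fun m => norm_nonneg _)
      (fun m => by rw [Real.norm_eq_abs, abs_mul, abs_pow]; gcongr) hμ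
  have hDρ : ∀ j, Summable fun k => ‖D j k * ρ ^ k‖ := fun j =>
    Summable.of_nonneg_of_le (fun m => norm_nonneg _)
      (fun m => by rw [Real.norm_eq_abs, abs_mul, abs_pow]; gcongr) (h.row ha j)
  rw [kernelSum, kernelSum, ((h.convCoeff ha hμ).summable hr hρ).tsum_prod,
    (h.summable hr hρ).tsum_prod, ← tsum_mul_left]
  refine tsum_congr fun j => ?_
  have h1 : ∑' k, D j k * r ^ j * ρ ^ k = r ^ j * ∑' k, D j k * ρ ^ k := by
    rw [← tsum_mul_left]; exact tsum_congr fun k => by ring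
  simp only [h1]
  rw [mul_left_comm, tsum_mul_tsum_eq_tsum_sum_antidiagonal_of_summable_norm hμρ (hDρ j),
    ← tsum_mul_left]
  refine tsum_congr fun k => ?_
  rw [convCoeff, Finset.sum_mul, Finset.sum_mul, Finset.mul_sum]
  refine Finset.sum_congr rfl fun q hq => ?_
  rw [← mem_antidiagonal.mp hq, pow_add]
  ring

/-- Identity theorem for double series on the open triangle. The substitution `ρ = t r` turns the
double series into a power series in `r` whose coefficients are polynomials in `t ∈ (0, 1)`. -/
theorem eq_zero_of_kernelSum_eq_zero {E : ℕ → ℕ → ℝ} {a : ℝ} (ha : 0 < a) (h : AbsConv E a)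
    (h0 : ∀ r ρ, 0 < ρ → ρ < r → r < a → kernelSum E r ρ = 0) (j k : ℕ) : E j k = 0 := by
  have h1 : ∀ t, 0 < t → t < 1 → ∀ i,
      ∑ q ∈ antidiagonal i, E q.1 q.2 * t ^ q.2 = 0 := by
    intro t ht ht1 i
    refine coeff_eq_zero_of_hasSum_zero ha i
      (c := fun i => ∑ q ∈ antidiagonal i, E q.1 q.2 * t ^ q.2) fun r hr hra => ?_
    have htr : t * r < r := by nlinarith
    have hs := hasSum_sum_antidiagonal (h.summable (r := r) (ρ := t * r)
      (by rw [abs_of_pos hr]; exact hra.le)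
      (by rw [abs_of_pos (by positivity)]; linarith))
    rw [← kernelSum, h0 r (t * r) (by positivity) htr hra] at hs
    refine hs.of_eq (fun i => ?_) rfl
    rw [Finset.sum_mul]
    refine Finset.sum_congr rfl fun q hq => ?_
    rw [← mem_antidiagonal.mp hq, pow_add, mul_pow]
    ring
  have h2 := coeff_eq_zero_of_hasSum_zero (a := 1) one_pos k
    (c := fun k' => if k' ≤ j + k then E (j + k - k') k' else 0) fun t ht ht1 => by
      have hz : ∀ k' ∉ Finset.range (j + k + 1),
          (if k' ≤ j + k then E (j + k - k') k' else 0) * t ^ k' = 0 := by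
        intro k' hk'
        rw [if_neg (by simpa using hk'), zero_mul]
      refine (hasSum_sum_of_ne_finset_zero hz).of_eq (fun _ => rfl) ?_
      refine Eq.trans ?_ (h1 t ht ht1 (j + k))
      rw [← Finset.Nat.sum_antidiagonal_swap,
        Finset.Nat.sum_antidiagonal_eq_sum_range_succ_mk]
      refine Finset.sum_congr rfl fun k' hk' => ?_
      have : k' ≤ j + k := by simpa [Nat.lt_succ_iff] using hk'
      simp [this]
  simpa using h2

/-! ### Analyticity of the sum of a double power series -/

/-- The homogeneous part of degree `i` of a double power series, as a multilinear map: the monomial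
`r^j ρ^k` is polarized by reading the first coordinate in the first `j` slots and the second
coordinate in the remaining ones. -/
noncomputable def kernelFPowerSeries (D : ℕ → ℕ → ℝ) :
    FormalMultilinearSeries ℝ (ℝ × ℝ) ℝ := fun i =>
  ∑ q ∈ antidiagonal i, D q.1 q.2 •
    (ContinuousMultilinearMap.mkPiAlgebra ℝ (Fin i) ℝ).compContinuousLinearMap
      (fun s : Fin i => if s.val < q.1 then ContinuousLinearMap.fst ℝ ℝ ℝ
        else ContinuousLinearMap.snd ℝ ℝ ℝ)

theorem kernelFPowerSeries_apply (D : ℕ → ℕ → ℝ) (i : ℕ) (x : ℝ × ℝ) :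
    (kernelFPowerSeries D i fun _ => x) =
      ∑ q ∈ antidiagonal i, D q.1 q.2 * x.1 ^ q.1 * x.2 ^ q.2 := by
  simp only [kernelFPowerSeries, sum_apply,
    smul_apply, ContinuousMultilinearMap.compContinuousLinearMap_apply,
    ContinuousMultilinearMap.mkPiAlgebra_apply, smul_eq_mul]
  refine Finset.sum_congr rfl fun q hq => ?_
  have hq' := mem_antidiagonal.mp hq
  rw [mul_assoc]
  congr 1
  have h1 : ∀ s : Fin i, (if s.val < q.1 then ContinuousLinearMap.fst ℝ ℝ ℝ
      else ContinuousLinearMap.snd ℝ ℝ ℝ) x = (fun s : ℕ => if s < q.1 then x.1 else x.2) s := by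
    intro s
    by_cases h : s.val < q.1 <;> simp [h]
  rw [Finset.prod_congr rfl fun s _ => h1 s,
    Fin.prod_univ_eq_prod_range (fun s : ℕ => if s < q.1 then x.1 else x.2) i, ← hq',
    Finset.prod_range_add]
  congr 1
  · rw [Finset.prod_congr rfl fun s hs => if_pos (Finset.mem_range.mp hs)]
    simp
  · simp

theorem norm_kernelFPowerSeries_le (D : ℕ → ℕ → ℝ) (i : ℕ) :
    ‖kernelFPowerSeries D i‖ ≤ ∑ q ∈ antidiagonal i, |D q.1 q.2| := by
  refine (norm_sum_le _ _).trans (Finset.sum_le_sum fun q _ => ?_)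
  rw [norm_smul, Real.norm_eq_abs]
  refine mul_le_of_le_one_right (abs_nonneg _) ?_
  refine (ContinuousMultilinearMap.norm_compContinuousLinearMap_le _ _).trans ?_
  have h1 : ‖ContinuousMultilinearMap.mkPiAlgebra ℝ (Fin i) ℝ‖ ≤ 1 := by simp
  refine mul_le_one₀ h1 (Finset.prod_nonneg fun _ _ => norm_nonneg _) ?_
  refine Finset.prod_le_one (fun _ _ => norm_nonneg _) fun s _ => ?_
  split_ifs
  · exact ContinuousLinearMap.norm_fst_le ..
  · exact ContinuousLinearMap.norm_snd_le ..

theorem AbsConv.analyticOnNhd {D : ℕ → ℕ → ℝ} {a : ℝ} (h : AbsConv D a) (ha : 0 < a) :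
    AnalyticOnNhd ℝ (fun x : ℝ × ℝ => kernelSum D x.1 x.2) (Metric.ball 0 a) := by
  have hball : HasFPowerSeriesOnBall (fun x : ℝ × ℝ => kernelSum D x.1 x.2)
      (kernelFPowerSeries D) 0 (ENNReal.ofReal a) := by
    refine ⟨?_, ENNReal.ofReal_pos.mpr ha, fun {y} hy => ?_⟩
    · refine (kernelFPowerSeries D).le_radius_of_summable_norm (r := a.toNNReal) ?_
      refine Summable.of_nonneg_of_le (fun i => by positivity) (fun i => ?_)
        (hasSum_sum_antidiagonal h).summable
      rw [Real.coe_toNNReal a ha.le]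
      refine (mul_le_mul_of_nonneg_right (norm_kernelFPowerSeries_le D i)
        (by positivity)).trans_eq ?_
      rw [Finset.sum_mul]
      refine Finset.sum_congr rfl fun q hq => ?_
      rw [← mem_antidiagonal.mp hq, pow_add]
      ring
    · rw [Metric.eball_ofReal, mem_ball_zero_iff, Prod.norm_def, max_lt_iff] at hy
      rw [zero_add]
      simp only [kernelFPowerSeries_apply]
      exact hasSum_sum_antidiagonal (h.summable (by simpa using hy.1.le) (by simpa using hy.2.le))
  have := hball.analyticOnNhd
  rwa [Metric.eball_ofReal] at this

/-! ### The kernel equations in terms of the coefficients -/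

/-- `r²` times the radial operator `∂_rr + (α / r) ∂_r` acts diagonally on the coefficients. -/
theorem AbsConv.radial_fst {D : ℕ → ℕ → ℝ} {a r ρ : ℝ} (h : AbsConv D a) (α : ℝ)
    (hr0 : r ≠ 0) (hr : |r| < a) (hρ : |ρ| < a) :
    r ^ 2 * iteratedDeriv 2 (fun s => kernelSum D s ρ) r
      + α * (r ^ 2 * (deriv (fun s => kernelSum D s ρ) r / r)) =
      kernelSum (fun j k => (j : ℝ) * (j - 1 + α) * D j k) r ρ := by
  obtain ⟨b, hb1, hba⟩ := exists_between (max_lt hr hρ)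
  have hrb : |r| < b := (le_max_left _ _).trans_lt hb1
  have hρb : |ρ| < b := (le_max_right _ _).trans_lt hb1
  have hb : 0 < b := (abs_nonneg r).trans_lt hrb
  obtain ⟨b', hbb', hb'a⟩ := exists_between hba
  have h1 := h.euler (hb.trans hbb').le hb'a
  have hs1 := (h1.anti hb.le hbb'.le).hasSum hrb.le hρb.le
  have hs2 := (h1.euler hb.le hbb').hasSum hrb.le hρb.le
  rw [h.sq_mul_iteratedDeriv_fst hr0 hr hρ, h.mul_deriv_fst hr0 hr hρ]
  exact (((hs2.sub hs1).add (hs1.mul_left α)).of_eq (fun q => by ring) rfl).tsum_eq.symm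

theorem AbsConv.radial_snd {D : ℕ → ℕ → ℝ} {a r ρ : ℝ} (h : AbsConv D a) (α : ℝ)
    (hρ0 : ρ ≠ 0) (hr : |r| < a) (hρ : |ρ| < a) :
    ρ ^ 2 * iteratedDeriv 2 (fun s => kernelSum D r s) ρ
      + α * (ρ ^ 2 * (deriv (fun s => kernelSum D r s) ρ / ρ)) =
      kernelSum (fun j k => (k : ℝ) * (k - 1 + α) * D j k) r ρ := by
  have := h.swap.radial_fst α hρ0 hρ hr
  simp only [kernelSum_swap D] at this
  rw [this, ← kernelSum_swap]

theorem AbsConv.radialWeight {D : ℕ → ℕ → ℝ} {a b : ℝ} (h : AbsConv D a) (α : ℝ) (hb : 0 ≤ b)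
    (hba : b < a) : AbsConv (fun j k => (j : ℝ) * (j - 1 + α) * D j k) b := by
  refine h.weight (w := fun j _ => (j : ℝ) * (j - 1 + α)) (K := 1 + |α|) hb hba fun j k => ?_
  have hj : (0 : ℝ) ≤ j := by positivity
  have hk : (0 : ℝ) ≤ k := by positivity
  have h1 : |(j : ℝ) - 1| ≤ j + 1 := abs_le.mpr ⟨by linarith, by linarith⟩
  calc |(j : ℝ) * (j - 1 + α)| = j * |(j : ℝ) - 1 + α| := by rw [abs_mul, Nat.abs_cast]
    _ ≤ (j + k + 1) * ((1 + |α|) * (j + k + 1)) := by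
        have h2 : |(j : ℝ) - 1 + α| ≤ (1 + |α|) * (j + k + 1) := by
          have := abs_add_le ((j : ℝ) - 1) α
          have h3 := abs_nonneg α
          nlinarith [mul_nonneg h3 hj, mul_nonneg h3 hk]
        gcongr
        linarith
    _ = _ := by ring

/-- Coefficients of `r² ρ²` times the kernel equation (left side moved to the right):
the factor `r² ρ²` clears the singular terms and turns all derivatives into Euler operators. -/
noncomputable def kernelResidual (N : ℝ) (μ : ℕ → ℝ) (C : ℕ → ℕ → ℝ) (j k : ℕ) : ℝ :=
  shiftCoeff 0 2 (fun j k => (j : ℝ) * (j - 1 + (3 - N)) * C j k) j k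
    - shiftCoeff 2 0 (fun j k => (k : ℝ) * (k - 1 + (N - 1)) * C j k) j k
    - shiftCoeff 2 2 (convCoeff μ C) j k

section

variable {N ε c a : ℝ} {μ : ℕ → ℝ} {C : ℕ → ℕ → ℝ} {lam : ℝ → ℝ} {n l : ℕ}

theorem summable_abs_coeff {b : ℝ} {f : ℝ → ℝ} (hb : 0 ≤ b) (hba : b < a)
    (hμ : ∀ x, |x| < a → HasSum (fun m => μ m * x ^ m) (f x)) :
    Summable fun m => |μ m| * b ^ m := by
  refine (hμ b (by rwa [abs_of_nonneg hb])).summable.abs.congr fun m => ?_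
  rw [abs_mul, abs_of_nonneg (pow_nonneg hb _)]

theorem AbsConv.kernelResidual {b : ℝ} {f : ℝ → ℝ} (hC : AbsConv C a)
    (hμ : ∀ x, |x| < a → HasSum (fun m => μ m * x ^ m) (f x)) (hb : 0 < b) (hba : b < a) :
    AbsConv (kernelResidual N μ C) b := by
  have h1 := (hC.radialWeight (3 - N) hb.le hba).shiftCoeff hb.le 0 2
  have h2 := (hC.swap.radialWeight (N - 1) hb.le hba).swap.shiftCoeff hb.le 2 0
  have h3 := ((hC.anti hb.le hba.le).convCoeff hb (summable_abs_coeff hb.le hba hμ)).shiftCoeff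
    hb.le 2 2
  exact (h1.sub h2 hb.le).sub h3 hb.le

theorem kernelPDEAt_iff (hC : AbsConv C a)
    (hμ : ∀ x, |x| < a → HasSum (fun m => μ m * x ^ m) ((lam x + c) / ε))
    {r ρ : ℝ} (hρ : 0 < ρ) (hρr : ρ < r) (hr : r < a) :
    KernelPDEAt n l ε c lam (kernelSum C) r ρ ↔
      kernelSum (kernelResidual (n + 2 * l) μ C) r ρ = 0 := by
  obtain ⟨b, hrb, hba⟩ := exists_between hr
  have hr0 : 0 < r := hρ.trans hρr
  have hb : 0 < b := hr0.trans hrb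
  have hr' : |r| ≤ b := by rw [abs_of_pos hr0]; exact hrb.le
  have hρ' : |ρ| ≤ b := by rw [abs_of_pos hρ]; linarith
  set N : ℝ := n + 2 * l with hN
  have w1 := hC.radialWeight (3 - N) hb.le hba
  have w2 := (hC.swap.radialWeight (N - 1) hb.le hba).swap
  have hμb := summable_abs_coeff hb.le hba hμ
  have w3 := (hC.anti hb.le hba.le).convCoeff hb hμb
  have key : kernelSum (kernelResidual N μ C) r ρ =
      r ^ 2 * ρ ^ 2 * (iteratedDeriv 2 (fun s => kernelSum C s ρ) r
      + (3 - (n : ℝ) - 2 * (l : ℝ)) * (deriv (fun s => kernelSum C s ρ) r / r)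
      - iteratedDeriv 2 (fun s => kernelSum C r s) ρ
      + (1 - (n : ℝ) - 2 * (l : ℝ)) * (deriv (fun s => kernelSum C r s) ρ / ρ)
      - (lam ρ + c) / ε * kernelSum C r ρ) := by
    have e1 := hC.radial_fst (3 - N) hr0.ne' (hr'.trans_lt hba) (hρ'.trans_lt hba)
    have e2 := hC.radial_snd (N - 1) hρ.ne' (hr'.trans_lt hba) (hρ'.trans_lt hba)
    have e3 := kernelSum_convCoeff (hC.anti hb.le hba.le) hb hμb hr' hρ'
    rw [(hμ ρ (hρ'.trans_lt hba)).tsum_eq] at e3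
    have s1 := w1.shiftCoeff hb.le 0 2
    have s2 := w2.shiftCoeff hb.le 2 0
    have s3 := w3.shiftCoeff hb.le 2 2
    unfold kernelResidual
    rw [kernelSum_sub (s1.sub s2 hb.le) s3 hr' hρ', kernelSum_sub s1 s2 hr' hρ',
      kernelSum_shiftCoeff 0 2 w1 hr' hρ', kernelSum_shiftCoeff 2 0 w2 hr' hρ',
      kernelSum_shiftCoeff 2 2 w3 hr' hρ', ← e1, ← e2, e3, hN]
    ring
  have hpos : r ^ 2 * ρ ^ 2 ≠ 0 := by positivity
  rw [key, mul_eq_zero, or_iff_right hpos, KernelPDEAt, sub_eq_zero, eq_comm]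

/-- The right-hand side of the condition on the diagonal as a power series. -/
theorem hasSum_integral_of_hasSum
    (hμ : ∀ x, |x| < a → HasSum (fun m => μ m * x ^ m) ((lam x + c) / ε))
    (hε : ε ≠ 0) {r : ℝ} (hr : 0 < r) (hra : r < a) :
    HasSum (fun m : ℕ => -(μ m / (2 * (m + 1))) * r ^ m)
      (-((∫ σ in (0 : ℝ)..r, (lam σ + c)) / (2 * r * ε))) := by
  have h1 : HasSum (fun m : ℕ => ∫ σ in (0 : ℝ)..r, ε * (μ m * σ ^ m))
      (∫ σ in (0 : ℝ)..r, (lam σ + c)) := by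
    refine intervalIntegral.hasSum_integral_of_dominated_convergence
      (fun m _ => |ε| * (|μ m| * r ^ m)) (fun m => ?_) (fun m => ?_) ?_ ?_ ?_
    · exact (by fun_prop : Continuous fun σ : ℝ => ε * (μ m * σ ^ m)).aestronglyMeasurable
    · refine Eventually.of_forall fun σ hσ => ?_
      rw [Set.uIoc_of_le hr.le] at hσ
      rw [Real.norm_eq_abs, abs_mul, abs_mul, abs_pow, abs_of_pos hσ.1]
      have := hσ.1
      have := hσ.2
      gcongr
    · exact Eventually.of_forall fun σ _ =>
        (summable_abs_coeff hr.le hra hμ).mul_left _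
    · exact intervalIntegrable_const
    · refine Eventually.of_forall fun σ hσ => ?_
      rw [Set.uIoc_of_le hr.le] at hσ
      refine ((hμ σ ?_).mul_left ε).of_eq (fun _ => rfl) (by field_simp)
      rw [abs_of_pos hσ.1]
      linarith [hσ.2]
  refine (h1.mul_left (-(1 / (2 * r * ε)))).of_eq (fun m => ?_) (by ring)
  rw [intervalIntegral.integral_const_mul, intervalIntegral.integral_const_mul, integral_pow]
  have : (m : ℝ) + 1 ≠ 0 := by positivity
  simp only [pow_succ, mul_zero, sub_zero]
  field_simp

theorem hasSum_diagonal (hC : AbsConv C a) {r : ℝ} (hr : |r| ≤ a) :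
    HasSum (fun i => (∑ q ∈ antidiagonal i, C q.1 q.2) * r ^ i) (kernelSum C r r) := by
  refine (hasSum_sum_antidiagonal (hC.summable hr hr)).of_eq (fun i => ?_) rfl
  rw [Finset.sum_mul]
  refine Finset.sum_congr rfl fun q hq => ?_
  rw [← mem_antidiagonal.mp hq, pow_add]
  ring

/-- The coefficient form of the kernel equations: a double sequence is a formal solution if the
kernel equation and the condition on the diagonal hold as identities of formal power series. -/
structure IsFormalSolution (N : ℝ) (μ : ℕ → ℝ) (C : ℕ → ℕ → ℝ) : Prop where
  residual : ∀ j k, kernelResidual N μ C j k = 0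
  diag : ∀ i : ℕ, ∑ q ∈ antidiagonal i, C q.1 q.2 = -(μ i / (2 * (i + 1)))

theorem IsPowerSeriesSolution.isFormalSolution {δ : ℝ}
    (h : IsPowerSeriesSolution n l ε c lam δ C) (hδ : 0 < δ) (ha : 0 < a) (hε : ε ≠ 0)
    (hμ : ∀ x, |x| < a → HasSum (fun m => μ m * x ^ m) ((lam x + c) / ε)) :
    IsFormalSolution (n + 2 * l) μ C := by
  have hCδ : AbsConv C δ := absConv_of_summable hδ.le (h.summable (δ, δ) ⟨hδ.le, le_rfl, le_rfl⟩)
  set a' := min δ a with ha'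
  have ha'0 : 0 < a' := lt_min hδ ha
  have hC : AbsConv C a' := hCδ.anti ha'0.le (min_le_left _ _)
  have hμ' : ∀ x, |x| < a' → HasSum (fun m => μ m * x ^ m) ((lam x + c) / ε) :=
    fun x hx => hμ x (hx.trans_le (min_le_right _ _))
  constructor
  · refine eq_zero_of_kernelSum_eq_zero (half_pos ha'0)
      (hC.kernelResidual hμ' (half_pos ha'0) (half_lt_self ha'0)) fun r ρ hρ hρr hr => ?_
    have hra : r < a' := hr.trans (half_lt_self ha'0)
    exact (kernelPDEAt_iff hC hμ' hρ hρr hra).mp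
      (h.pde r ρ hρ hρr (hra.trans_le (min_le_left _ _)))
  · intro i
    have := coeff_eq_zero_of_hasSum_zero ha'0 i
      (c := fun i => ∑ q ∈ antidiagonal i, C q.1 q.2 - -(μ i / (2 * (i + 1)))) fun r hr hra => by
        have h1 := hasSum_diagonal hC (r := r) (by rw [abs_of_pos hr]; exact hra.le)
        have h2 := hasSum_integral_of_hasSum hμ' hε hr hra
        have h3 : kernelSum C r r = _ := h.bc r hr (hra.le.trans (min_le_left _ _))
        exact (h1.sub h2).of_eq (fun i => by ring) (by rw [h3, sub_self])
    linarith

theorem IsFormalSolution.isPowerSeriesSolution {δ : ℝ}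
    (h : IsFormalSolution (n + 2 * l) μ C) (hδa : δ < a) (hε : ε ≠ 0) (hC : AbsConv C a)
    (hμ : ∀ x, |x| < a → HasSum (fun m => μ m * x ^ m) ((lam x + c) / ε)) :
    IsPowerSeriesSolution n l ε c lam δ C where
  summable x hx := by
    obtain ⟨h1, h2, h3⟩ := hx
    refine hC.summable ?_ ?_
    · rw [abs_of_nonneg (h1.trans h2)]; linarith
    · rw [abs_of_nonneg h1]; linarith
  pde r ρ hρ hρr hr := by
    rw [kernelPDEAt_iff hC hμ hρ hρr (hr.trans hδa)]
    simp [kernelSum, h.residual]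
  bc r hr hrδ := by
    have hra := hrδ.trans_lt hδa
    refine (hasSum_diagonal hC (by rw [abs_of_pos hr]; exact hra.le)).unique ?_
    simp only [h.diag]
    exact hasSum_integral_of_hasSum hμ hε hr hra

/-- The identities between coefficients that express the kernel equation: one recursion, and two
conditions coming from the singular terms `∂_r G / r` and `∂_ρ G / ρ`. -/
theorem kernelResidual_eq_zero_iff :
    (∀ j k, kernelResidual N μ C j k = 0) ↔
      (∀ j k : ℕ, ((j : ℝ) + 2) * (j + 4 - N) * C (j + 2) k
        = (k + 2) * (k + N) * C j (k + 2) + convCoeff μ C j k) ∧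
      (∀ k, (3 - N) * C 1 k = 0) ∧ ∀ j, (N - 1) * C j 1 = 0 := by
  constructor
  · intro h
    refine ⟨fun j k => ?_, fun k => ?_, fun j => ?_⟩
    · have := h (j + 2) (k + 2)
      simp only [kernelResidual, shiftCoeff, zero_le, Nat.le_add_left, and_self, if_true,
        Nat.add_sub_cancel, Nat.sub_zero] at this
      push_cast at this
      linear_combination this
    · have := h 1 (k + 2)
      simpa [kernelResidual, shiftCoeff] using this
    · have := h (j + 2) 1
      simpa [kernelResidual, shiftCoeff] using this
  · rintro ⟨h1, h2, h3⟩ j k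
    rcases j with _ | _ | j <;> rcases k with _ | _ | k <;>
      simp [kernelResidual, shiftCoeff]
    · simpa using h2 k
    · simpa using h3 j
    · have := h1 j k
      linear_combination this

end

/-! ### Homogeneous solutions -/

/-- The weights `w_s` generated from `w_0 = 1` by the coefficient recursion of the kernel equation
without the zero-order term, in the degree `2x` and with `N = 2ν`: the homogeneous part of degree `2x`
of a solution is a multiple of `∑ w_s r^(2x-2s) ρ^(2s)`. For odd degrees `x` is a half-integer. -/
noncomputable def homWeight (ν x : ℝ) (s : ℕ) : ℝ :=
  ∏ t ∈ Finset.range s, ((x - t) * (x - t + 1 - ν)) / ((t + 1) * (t + ν))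

theorem homWeight_zero (ν x : ℝ) : homWeight ν x 0 = 1 := by simp [homWeight]

theorem homWeight_succ {ν : ℝ} (hν : 0 < ν) (x : ℝ) (s : ℕ) :
    ((s : ℝ) + 1) * (s + ν) * homWeight ν x (s + 1) =
      (x - s) * (x - s + 1 - ν) * homWeight ν x s := by
  rw [homWeight, Finset.prod_range_succ, ← homWeight]
  have : (s : ℝ) + ν ≠ 0 := by positivity
  field_simp

theorem smeval_descPochhammer_eq_prod (x : ℝ) (k : ℕ) :
    (descPochhammer ℤ k).smeval x = ∏ t ∈ Finset.range k, (x - t) := by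
  induction k with
  | zero => simp
  | succ k ih =>
    rw [descPochhammer_succ_right, Polynomial.smeval_mul, ih, Finset.prod_range_succ,
      Polynomial.smeval_sub, Polynomial.smeval_X, pow_one, Polynomial.smeval_natCast]
    simp

theorem homWeight_mul_prod {ν : ℝ} (hν : 0 < ν) {d s : ℕ} (hs : s ≤ d) :
    homWeight ν d s * ∏ t ∈ Finset.range d, ((t : ℝ) + ν) =
      d.choose s * ((∏ t ∈ Finset.range s, (d + 1 - ν - t)) *
        ∏ t ∈ Finset.range (d - s), (ν + d - 1 - t)) := by
  have h1 : ∏ t ∈ Finset.range (d - s), (ν + d - 1 - t) =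
      ∏ t ∈ Finset.range (d - s), (((s + t : ℕ) : ℝ) + ν) := by
    rw [← Finset.prod_range_reflect]
    refine Finset.prod_congr rfl fun t ht => ?_
    have ht' := Finset.mem_range.mp ht
    have : d = (d - s - 1 - t) + 1 + t + s := by omega
    have h' : (d : ℝ) = ((d - s - 1 - t : ℕ) : ℝ) + 1 + t + s := by exact_mod_cast this
    push_cast
    linear_combination h'
  have h2 : ∏ t ∈ Finset.range d, ((t : ℝ) + ν) = (∏ t ∈ Finset.range s, ((t : ℝ) + ν)) *
      ∏ t ∈ Finset.range (d - s), (((s + t : ℕ) : ℝ) + ν) := by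
    rw [← Finset.prod_range_add (fun t : ℕ => (t : ℝ) + ν), Nat.add_sub_cancel' hs]
  have h3 : homWeight ν d s * ∏ t ∈ Finset.range s, ((t : ℝ) + ν) =
      d.choose s * ∏ t ∈ Finset.range s, (d + 1 - ν - t) := by
    clear h1 h2
    induction s with
    | zero => simp [homWeight]
    | succ s ih =>
      have hc : (d.choose (s + 1) : ℝ) * (s + 1) = d.choose s * (d - s) := by
        have := Nat.choose_succ_right_eq d s
        rw [← Nat.cast_sub (by omega)]
        exact_mod_cast this
      have hw := homWeight_succ hν d s
      have h := ih (by omega)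
      rw [Finset.prod_range_succ, Finset.prod_range_succ]
      have hs0 : (s : ℝ) + 1 ≠ 0 := by positivity
      refine mul_left_cancel₀ hs0 ?_
      linear_combination (∏ t ∈ Finset.range s, ((t : ℝ) + ν)) * hw
        + (d - s) * (d - s + 1 - ν) * h
        - (∏ t ∈ Finset.range s, (d + 1 - ν - t)) * (d + 1 - ν - s) * hc
  rw [h1, h2, ← mul_assoc, h3]
  ring

/-- By the Chu–Vandermonde identity the homogeneous solution of even degree `2d` takes the value
`(2d)(2d-1)⋯(d+1) / (ν(ν+1)⋯(ν+d-1))` at `r = ρ = 1`. -/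
theorem sum_homWeight_ne_zero {ν : ℝ} (hν : 0 < ν) (d : ℕ) :
    ∑ s ∈ Finset.range (d + 1), homWeight ν d s ≠ 0 := by
  intro h0
  have hV := Ring.descPochhammer_smeval_add (r := (d : ℝ) + 1 - ν) (s := ν + d - 1) d
    (Commute.all _ _)
  simp only [smeval_descPochhammer_eq_prod] at hV
  rw [Finset.Nat.sum_antidiagonal_eq_sum_range_succ_mk] at hV
  have h1 : (∑ s ∈ Finset.range (d + 1), homWeight ν d s) *
      ∏ t ∈ Finset.range d, ((t : ℝ) + ν) =
      ∏ t ∈ Finset.range d, ((d : ℝ) + 1 - ν + (ν + d - 1) - t) := by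
    rw [hV, Finset.sum_mul]
    refine Finset.sum_congr rfl fun s hs => ?_
    rw [homWeight_mul_prod hν (by simpa [Nat.lt_succ_iff] using hs)]
  rw [h0, zero_mul] at h1
  refine (Finset.prod_pos fun t ht => ?_).ne h1
  have : (t : ℝ) < d := by exact_mod_cast Finset.mem_range.mp ht
  have : (0 : ℝ) ≤ t := by positivity
  linarith

theorem sum_range_eq_sum_even {f : ℕ → ℝ} (hf : ∀ k, Odd k → f k = 0) (i : ℕ) :
    ∑ k ∈ Finset.range (i + 1), f k = ∑ s ∈ Finset.range (i / 2 + 1), f (2 * s) := by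
  induction i with
  | zero => simp
  | succ i ih =>
    rw [Finset.sum_range_succ, ih]
    rcases Nat.even_or_odd' i with ⟨d, rfl | rfl⟩
    · rw [hf _ ⟨d, rfl⟩, add_zero, show (2 * d + 1) / 2 = 2 * d / 2 by omega]
    · rw [show (2 * d + 1 + 1) / 2 = (2 * d + 1) / 2 + 1 by omega, Finset.sum_range_succ _ (_ + 1),
        show 2 * ((2 * d + 1) / 2 + 1) = 2 * d + 1 + 1 by omega]

section

variable {M i : ℕ} {X : ℕ → ℕ → ℝ}

theorem eq_zero_of_odd_snd (hrec : ∀ j k : ℕ, j + k + 2 = i →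
      ((j : ℝ) + 2) * (j + 4 - M) * X (j + 2) k = (k + 2) * (k + M) * X j (k + 2))
    (h1 : ∀ j, j + 1 = i → X j 1 = 0) (s : ℕ) :
    ∀ j, j + (2 * s + 1) = i → X j (2 * s + 1) = 0 := by
  induction s with
  | zero => simpa using h1
  | succ s ih =>
    intro j hj
    have h := hrec j (2 * s + 1) (by omega)
    rw [ih (j + 2) (by omega), mul_zero] at h
    have h2 : (((2 * s + 1 : ℕ) : ℝ) + 2) * ((2 * s + 1 : ℕ) + M) ≠ 0 := by positivity
    exact (mul_eq_zero.mp h.symm).resolve_left h2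

theorem eq_homWeight_mul (hM : 0 < M) (hrec : ∀ j k : ℕ, j + k + 2 = i →
      ((j : ℝ) + 2) * (j + 4 - M) * X (j + 2) k = (k + 2) * (k + M) * X j (k + 2)) (s : ℕ) :
    2 * s ≤ i → X (i - 2 * s) (2 * s) = homWeight (M / 2) (i / 2) s * X i 0 := by
  induction s with
  | zero => simp [homWeight_zero]
  | succ s ih =>
    intro hs
    obtain ⟨j, rfl⟩ : ∃ j, i = j + 2 * s + 2 := ⟨i - 2 * s - 2, by omega⟩
    have h := hrec j (2 * s) (by omega)
    have ih' := ih (by omega)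
    rw [show j + 2 * s + 2 - 2 * s = j + 2 by omega] at ih'
    rw [show j + 2 * s + 2 - 2 * (s + 1) = j by omega, show 2 * (s + 1) = 2 * s + 2 by ring]
    have hMr : (0 : ℝ) < M := by exact_mod_cast hM
    have hw := homWeight_succ (half_pos hMr) (((j + 2 * s + 2 : ℕ) : ℝ) / 2) s
    rw [ih'] at h
    push_cast at h hw ⊢
    have h2 : (2 * (s : ℝ) + 2) * (2 * s + M) ≠ 0 := by positivity
    refine mul_left_cancel₀ h2 ?_
    linear_combination (-1) * h - 4 * X (j + 2 * s + 2) 0 * hw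

theorem sum_antidiagonal_eq_homWeight (hM : 0 < M) (hrec : ∀ j k : ℕ, j + k + 2 = i →
      ((j : ℝ) + 2) * (j + 4 - M) * X (j + 2) k = (k + 2) * (k + M) * X j (k + 2))
    (h1 : ∀ j, j + 1 = i → X j 1 = 0) :
    ∑ q ∈ antidiagonal i, X q.1 q.2 =
      (∑ s ∈ Finset.range (i / 2 + 1), homWeight (M / 2) (i / 2) s) * X i 0 := by
  have h := sum_range_eq_sum_even (f := fun k => if k ≤ i then X (i - k) k else 0) (by
    rintro k ⟨s, rfl⟩
    split_ifs with hk
    · exact eq_zero_of_odd_snd hrec h1 s _ (by omega)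
    · rfl) i
  rw [← Finset.Nat.sum_antidiagonal_swap, Finset.Nat.sum_antidiagonal_eq_sum_range_succ_mk,
    Finset.sum_mul]
  refine Eq.trans ?_ (h.trans ?_)
  · refine Finset.sum_congr rfl fun k hk => ?_
    rw [if_pos (by simpa [Nat.lt_succ_iff] using hk)]
    rfl
  · refine Finset.sum_congr rfl fun s hs => ?_
    have : 2 * s ≤ i := by have := Finset.mem_range.mp hs; omega
    rw [if_pos this, eq_homWeight_mul hM hrec s this]

theorem eq_zero_of_fst_eq_zero (hM : 0 < M) (hrec : ∀ j k : ℕ, j + k + 2 = i →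
      ((j : ℝ) + 2) * (j + 4 - M) * X (j + 2) k = (k + 2) * (k + M) * X j (k + 2))
    (h1 : ∀ j, j + 1 = i → X j 1 = 0) (h0 : X i 0 = 0) (j k : ℕ) (hjk : j + k = i) :
    X j k = 0 := by
  rcases Nat.even_or_odd' k with ⟨s, rfl | rfl⟩
  · have := eq_homWeight_mul hM hrec s (by omega)
    rw [h0, mul_zero] at this
    rwa [show j = i - 2 * s by omega]
  · exact eq_zero_of_odd_snd hrec h1 s j hjk

/-- In odd degree the vanishing of the coefficient of `r ρ^(i-1)` forces the whole homogeneous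
part to vanish, unless the recursion from `r^i` down to `r` meets the resonance `j = N - 2`. -/
theorem eq_zero_of_odd_of_nonresonant (hM : 0 < M) (hrec : ∀ j k : ℕ, j + k + 2 = i →
      ((j : ℝ) + 2) * (j + 4 - M) * X (j + 2) k = (k + 2) * (k + M) * X j (k + 2))
    (h1 : ∀ j, j + 1 = i → X j 1 = 0) (hX : ∀ k, 1 + k = i → X 1 k = 0) (hi : Odd i)
    (hres : Even M ∨ i + 2 < M) : ∀ j k, j + k = i → X j k = 0 := by
  refine eq_zero_of_fst_eq_zero hM hrec h1 ?_
  obtain ⟨d, rfl⟩ := hi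
  have h := eq_homWeight_mul hM hrec d (by omega)
  rw [show 2 * d + 1 - 2 * d = 1 by omega, hX _ (by omega)] at h
  refine (mul_eq_zero.mp h.symm).resolve_left ?_
  refine Finset.prod_ne_zero_iff.mpr fun t ht => div_ne_zero (mul_ne_zero ?_ ?_) ?_
  · have : (t : ℝ) < d := by exact_mod_cast Finset.mem_range.mp ht
    push_cast
    intro h
    linarith
  · intro h
    have h2 : 2 * d + 3 = M + 2 * t := by
      have : ((2 * d + 3 : ℕ) : ℝ) = (M + 2 * t : ℕ) := by
        push_cast at h ⊢
        linarith
      exact_mod_cast this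
    have := Finset.mem_range.mp ht
    rcases hres with ⟨m, rfl⟩ | hres <;> omega
  · positivity

/-- In the resonant odd case all weights are nonnegative. -/
theorem homWeight_nonneg_of_resonant (hM : Odd M) (hi : Odd i) (hMi : M ≤ i + 2) (s : ℕ)
    (hs : 2 * s ≤ i) :
    0 ≤ homWeight (M / 2) (i / 2) s ∧
      (homWeight (M / 2) (i / 2) s ≠ 0 → M + 2 * s ≤ i + 2) := by
  have hMr : (0 : ℝ) < M := by exact_mod_cast hM.pos
  induction s with
  | zero => exact ⟨by simp [homWeight], fun _ => by simpa using hMi⟩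
  | succ s ih =>
    obtain ⟨h0, h1⟩ := ih (by omega)
    have hw := homWeight_succ (half_pos hMr) ((i : ℝ) / 2) s
    have hpos : 0 < ((s : ℝ) + 1) * (s + (M : ℝ) / 2) := by positivity
    have his : (2 : ℝ) * s ≤ i := by exact_mod_cast (by omega : 2 * s ≤ i)
    by_cases hz : homWeight (M / 2) (i / 2) s = 0
    · rw [hz, mul_zero] at hw
      have := (mul_eq_zero.mp hw).resolve_left hpos.ne'
      exact ⟨this.ge, fun h => absurd this h⟩
    · have h2 := h1 hz
      have h2' : (M : ℝ) + 2 * s ≤ i + 2 := by exact_mod_cast h2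
      refine ⟨?_, fun h3 => ?_⟩
      · refine nonneg_of_mul_nonneg_right ?_ hpos
        rw [hw]
        refine mul_nonneg (mul_nonneg ?_ ?_) h0 <;> linarith
      · by_contra hlt
        have h4 : M + 2 * s = i + 2 := by
          obtain ⟨m, rfl⟩ := hM
          obtain ⟨d, rfl⟩ := hi
          omega
        have h4' : (M : ℝ) + 2 * s = i + 2 := by exact_mod_cast h4
        rw [show (i : ℝ) / 2 - s + 1 - M / 2 = 0 by linarith, mul_zero, zero_mul] at hw
        exact h3 ((mul_eq_zero.mp hw).resolve_left hpos.ne')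

/-- A homogeneous solution that vanishes on the diagonal is zero. -/
theorem homogeneous_eq_zero (hM : 2 ≤ M) (hrec : ∀ j k : ℕ, j + k + 2 = i →
      ((j : ℝ) + 2) * (j + 4 - M) * X (j + 2) k = (k + 2) * (k + M) * X j (k + 2))
    (h1 : ∀ j, j + 1 = i → X j 1 = 0) (hX : ∀ k, 1 + k = i → (3 - (M : ℝ)) * X 1 k = 0)
    (hsum : ∑ q ∈ antidiagonal i, X q.1 q.2 = 0) : ∀ j k, j + k = i → X j k = 0 := by
  have hM0 : 0 < M := by omega
  have hMr : (0 : ℝ) < M := by exact_mod_cast hM0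
  rw [sum_antidiagonal_eq_homWeight hM0 hrec h1, mul_eq_zero] at hsum
  rcases Nat.even_or_odd i with hi | hi
  · refine eq_zero_of_fst_eq_zero hM0 hrec h1 (hsum.resolve_left ?_)
    obtain ⟨d, rfl⟩ := hi
    rw [show (d + d) / 2 = d by omega, show ((d + d : ℕ) : ℝ) / 2 = d by push_cast; ring]
    exact sum_homWeight_ne_zero (half_pos hMr) d
  · by_cases hres : Even M ∨ i + 2 < M
    · refine eq_zero_of_odd_of_nonresonant hM0 hrec h1 (fun k hk => ?_) hi hres
      refine (mul_eq_zero.mp (hX k hk)).resolve_left fun h3 => ?_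
      have h4 : 3 = M := by
        have : ((3 : ℕ) : ℝ) = M := by push_cast; linarith
        exact_mod_cast this
      have := hi.pos
      rcases hres with ⟨m, hm⟩ | hres <;> omega
    · rw [not_or, Nat.not_even_iff_odd, not_lt] at hres
      refine eq_zero_of_fst_eq_zero hM0 hrec h1 (hsum.resolve_left (ne_of_gt ?_))
      rw [Finset.sum_range_succ']
      refine add_pos_of_nonneg_of_pos (Finset.sum_nonneg fun s hs => ?_) ?_
      · exact (homWeight_nonneg_of_resonant hres.1 hi hres.2 (s + 1)
          (by have := Finset.mem_range.mp hs; omega)).1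
      · rw [homWeight_zero]
        exact one_pos

end

/-! ### Uniqueness, and obstruction for odd Maclaurin coefficients -/

section

variable {n l : ℕ} {μ : ℕ → ℝ} {C C' : ℕ → ℕ → ℝ}

theorem convCoeff_congr {j k : ℕ} (h : ∀ k' ≤ k, C j k' = C' j k') :
    convCoeff μ C j k = convCoeff μ C' j k :=
  Finset.sum_congr rfl fun q hq => by
    rw [h q.2 (by have := mem_antidiagonal.mp hq; omega)]

theorem IsFormalSolution.unique (hn : 1 < n) (h : IsFormalSolution (n + 2 * l) μ C)
    (h' : IsFormalSolution (n + 2 * l) μ C') : C' = C := by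
  obtain ⟨r1, r2, r3⟩ := kernelResidual_eq_zero_iff.mp h.residual
  obtain ⟨r1', r2', r3'⟩ := kernelResidual_eq_zero_iff.mp h'.residual
  have hN : ((n + 2 * l : ℕ) : ℝ) = n + 2 * l := by push_cast; ring
  have hn' : (1 : ℝ) < n := by exact_mod_cast hn
  have hl : (0 : ℝ) ≤ l := by positivity
  suffices H : ∀ i j k, j + k = i → C' j k - C j k = 0 by
    funext j k
    exact sub_eq_zero.mp (H _ j k rfl)
  intro i
  induction i using Nat.strong_induction_on with
  | _ i ih =>
    refine homogeneous_eq_zero (M := n + 2 * l) (X := fun j k => C' j k - C j k) (by omega)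
      (fun j k hjk => ?_) (fun j hj => ?_) (fun k hk => ?_) ?_
    · have hc : convCoeff μ C' j k = convCoeff μ C j k :=
        convCoeff_congr fun k' hk' => sub_eq_zero.mp (ih (j + k') (by omega) j k' rfl)
      rw [hN]
      linear_combination r1' j k - r1 j k + hc
    · have hne : (n : ℝ) + 2 * l - 1 ≠ 0 := by linarith
      refine mul_left_cancel₀ hne ?_
      linear_combination r3' j - r3 j
    · rw [hN]
      linear_combination r2' k - r2 k
    · rw [Finset.sum_sub_distrib, h.diag, h'.diag, sub_self]

/-- If the first odd Maclaurin coefficient has index `i < N - 2`, then a formal solution would have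
no terms of odd degree up to `i`, which contradicts the condition on the diagonal in degree `i`. -/
theorem IsFormalSolution.odd_coeff_eq_zero (hn : 1 < n) (h : IsFormalSolution (n + 2 * l) μ C)
    {i₀ : ℕ} (hi₀ : Odd i₀) (hlt : i₀ + 2 < n + 2 * l) (hμ : ∀ m < i₀, Odd m → μ m = 0) :
    μ i₀ = 0 := by
  obtain ⟨r1, r2, r3⟩ := kernelResidual_eq_zero_iff.mp h.residual
  have hN : ((n + 2 * l : ℕ) : ℝ) = n + 2 * l := by push_cast; ring
  have hn' : (1 : ℝ) < n := by exact_mod_cast hn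
  have hl : (0 : ℝ) ≤ l := by positivity
  have H : ∀ i, Odd i → i ≤ i₀ → ∀ j k, j + k = i → C j k = 0 := by
    intro i
    induction i using Nat.strong_induction_on with
    | _ i ih =>
      intro hi hii₀
      refine eq_zero_of_odd_of_nonresonant (M := n + 2 * l) (by omega)
        (fun j k hjk => ?_) (fun j hj => ?_) (fun k hk => ?_) hi (Or.inr (by omega))
      · have hc : convCoeff μ C j k = 0 := by
          refine Finset.sum_eq_zero fun q hq => ?_
          have hq' := mem_antidiagonal.mp hq
          rcases Nat.even_or_odd q.1 with hq1 | hq1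
          · rw [ih (j + q.2) (by omega) ?_ (by omega) j q.2 rfl, mul_zero]
            obtain ⟨m, hm⟩ := hq1
            obtain ⟨d, hd⟩ := hi
            exact ⟨d - 1 - m, by omega⟩
          · rw [hμ q.1 (by omega) hq1, zero_mul]
        rw [hN]
        linear_combination r1 j k + hc
      · have hne : (n : ℝ) + 2 * l - 1 ≠ 0 := by linarith
        exact (mul_eq_zero.mp (r3 j)).resolve_left hne
      · refine (mul_eq_zero.mp (r2 k)).resolve_left fun h3 => ?_
        have hi0 : 1 ≤ i₀ := hi₀.pos
        have h4 : ((i₀ + 2 : ℕ) : ℝ) < (n + 2 * l : ℕ) := by exact_mod_cast hlt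
        have h5 : (1 : ℝ) ≤ i₀ := by exact_mod_cast hi0
        push_cast at h4
        linarith
  have hd := h.diag i₀
  rw [Finset.sum_eq_zero fun q hq => H i₀ hi₀ le_rfl q.1 q.2 (mem_antidiagonal.mp hq)] at hd
  have h2 : (2 * ((i₀ : ℝ) + 1)) ≠ 0 := by positivity
  have h3 : μ i₀ / (2 * ((i₀ : ℝ) + 1)) = 0 := by linarith
  exact (div_eq_zero_iff.mp h3).resolve_right h2

end

/-! ### The two-point problem in one degree -/

/-- The coefficients of one even degree `2d` are determined by the source `h` and the prescribed sum
`b`: a multiple of the homogeneous solution, whose sum is nonzero, adjusts the sum. -/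
theorem exists_degree_solution {ν : ℝ} (hν : 0 < ν) (d : ℕ) (h : ℕ → ℝ) (b : ℝ) :
    ∃ B : ℕ → ℝ, (∀ s : ℕ, ((s : ℝ) + 1) * (s + ν) * B (s + 1) =
        ((d : ℝ) - s) * (d - s + 1 - ν) * B s - h s) ∧
      ∑ s ∈ Finset.range (d + 1), B s = b := by
  obtain ⟨e, he⟩ : ∃ e : ℕ → ℝ, ∀ s : ℕ, e (s + 1) =
      (((d : ℝ) - s) * (d - s + 1 - ν) * e s - h s) / ((s + 1) * (s + ν)) :=
    ⟨fun s => Nat.rec 0 (fun s es =>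
      (((d : ℝ) - s) * (d - s + 1 - ν) * es - h s) / ((s + 1) * (s + ν))) s, fun s => rfl⟩
  have hS := sum_homWeight_ne_zero hν d
  set S := ∑ s ∈ Finset.range (d + 1), homWeight ν d s
  set y := (b - ∑ s ∈ Finset.range (d + 1), e s) / S with hy
  refine ⟨fun s => y * homWeight ν d s + e s, fun s => ?_, ?_⟩
  · have hw := homWeight_succ hν d s
    have h1 : ((s : ℝ) + 1) * (s + ν) * e (s + 1) =
        ((d : ℝ) - s) * (d - s + 1 - ν) * e s - h s := by
      rw [he, mul_div_cancel₀]
      positivity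
    linear_combination y * hw + h1
  · rw [Finset.sum_add_distrib, ← Finset.mul_sum, hy, div_mul_cancel₀ _ hS]
    ring

section

variable {ν : ℝ} {d s₀ : ℕ}

/- The recursion reads `α_s B_(s+1) = β_s B_s - h_s` with `α_s = (s+1)(s+ν)`,
`β_s = (d-s)(d-s+1-ν)` and `β_s - α_s = (d+1)(d-ν-2s)`. It is stable in the direction of increasing
`s` where `2s ≥ d - ν`, and in the direction of decreasing `s` where `2s ≤ d - ν`. -/

theorem forward_stable (hν : 0 < ν) (hd : 4 * ν ≤ d) {s : ℕ} (hs : (d : ℝ) - ν ≤ 2 * s)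
    (hsd : s < d) : |((d : ℝ) - s) * (d - s + 1 - ν)| ≤ ((s : ℝ) + 1) * (s + ν) ∧
      (d : ℝ) ^ 2 / 16 ≤ ((s : ℝ) + 1) * (s + ν) := by
  have hsd' : (s : ℝ) + 1 ≤ d := by exact_mod_cast hsd
  have h1 : 3 / 8 * (d : ℝ) ≤ s := by linarith
  refine ⟨abs_le.mpr ⟨?_, ?_⟩, by nlinarith⟩
  · by_cases hneg : 0 ≤ (d : ℝ) - s + 1 - ν
    · have h2 : 0 ≤ ((d : ℝ) - s) * (d - s + 1 - ν) := mul_nonneg (by linarith) hneg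
      have h3 : 0 ≤ ((s : ℝ) + 1) * (s + ν) := by positivity
      linarith
    · push Not at hneg
      have h2 : ((d : ℝ) - s) * (ν - 1 - (d - s)) ≤ ν * ν :=
        mul_le_mul (by linarith) (by linarith) (by linarith) hν.le
      have h3 : ν * ν ≤ ((s : ℝ) + 1) * (s + ν) :=
        mul_le_mul (by linarith) (by linarith) hν.le (by linarith)
      linarith
  · have : 0 ≤ ((d : ℝ) + 1) * (2 * s - (d - ν)) := mul_nonneg (by positivity) (by linarith)
    linarith

theorem backward_stable (hν : 0 < ν) (hd : 4 * ν ≤ d) {s : ℕ} (hs : 2 * (s : ℝ) ≤ d - ν) :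
    ((s : ℝ) + 1) * (s + ν) ≤ ((d : ℝ) - s) * (d - s + 1 - ν) ∧
      (d : ℝ) ^ 2 / 16 ≤ ((d : ℝ) - s) * (d - s + 1 - ν) := by
  constructor
  · have : 0 ≤ ((d : ℝ) + 1) * ((d - ν) - 2 * s) := mul_nonneg (by positivity) (by linarith)
    linarith
  · have h1 : (d : ℝ) / 2 ≤ d - s := by linarith
    have h2 : (d : ℝ) / 8 ≤ d - s + 1 - ν := by linarith
    calc (d : ℝ) ^ 2 / 16 = d / 2 * (d / 8) := by ring
      _ ≤ _ := mul_le_mul h1 h2 (by positivity) (by linarith)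

/-- A solution of the recursion in degree `d` is controlled by its value at the pivot `s₀`. -/
theorem abs_le_of_pivot (hν : 0 < ν) (hd : 4 * ν ≤ d) {X h : ℕ → ℝ}
    (hlow : ∀ s < s₀, 2 * (s : ℝ) ≤ d - ν) (hup : ∀ s, s₀ ≤ s → (d : ℝ) - ν ≤ 2 * s)
    (hs₀ : s₀ ≤ d)
    (hX : ∀ s < d, ((s : ℝ) + 1) * (s + ν) * X (s + 1) =
        ((d : ℝ) - s) * (d - s + 1 - ν) * X s - h s) {s : ℕ} (hs : s ≤ d) :
    |X s| ≤ |X s₀| + 16 / (d : ℝ) ^ 2 * ∑ t ∈ Finset.range d, |h t| := by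
  have hd0 : (0 : ℝ) < d := by linarith
  have hinv : ∀ α y : ℝ, (d : ℝ) ^ 2 / 16 ≤ α → 0 ≤ y → y ≤ α * (16 / (d : ℝ) ^ 2 * y) := by
    intro α y hα hy
    calc y = (d : ℝ) ^ 2 / 16 * (16 / (d : ℝ) ^ 2 * y) := by field_simp
      _ ≤ _ := by gcongr
  rcases le_total s₀ s with hss | hss
  · suffices H : s ≤ d → |X s| ≤ |X s₀| + 16 / (d : ℝ) ^ 2 * ∑ t ∈ Finset.Ico s₀ s, |h t| by
      refine (H hs).trans ?_
      gcongr
      intro t ht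
      simp only [Finset.mem_Ico, Finset.mem_range] at ht ⊢
      omega
    clear hs
    induction s, hss using Nat.le_induction with
    | base => simp
    | succ s hss ih =>
      intro hs
      obtain ⟨h1, h2⟩ := forward_stable hν hd (hup s hss) (by omega)
      have hα : 0 < ((s : ℝ) + 1) * (s + ν) := by positivity
      rw [Finset.sum_Ico_succ_top hss, mul_add, ← add_assoc]
      refine le_trans ?_ (add_le_add_left (ih (by omega)) _)
      refine le_of_mul_le_mul_left ?_ hα
      calc ((s : ℝ) + 1) * (s + ν) * |X (s + 1)|
          = |((d : ℝ) - s) * (d - s + 1 - ν) * X s - h s| := by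
            rw [← hX s (by omega), abs_mul, abs_of_pos hα]
        _ ≤ |((d : ℝ) - s) * (d - s + 1 - ν)| * |X s| + |h s| := by
            rw [← abs_mul]; exact abs_sub _ _
        _ ≤ ((s : ℝ) + 1) * (s + ν) * |X s|
            + ((s : ℝ) + 1) * (s + ν) * (16 / (d : ℝ) ^ 2 * |h s|) := by
            gcongr
            exact hinv _ _ h2 (abs_nonneg _)
        _ = _ := by ring
  · suffices H : ∀ k ≤ s₀, |X (s₀ - k)| ≤
        |X s₀| + 16 / (d : ℝ) ^ 2 * ∑ t ∈ Finset.Ico (s₀ - k) s₀, |h t| by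
      have := H (s₀ - s) (by omega)
      rw [Nat.sub_sub_self hss] at this
      refine this.trans ?_
      gcongr
      intro t ht
      simp only [Finset.mem_Ico, Finset.mem_range] at ht ⊢
      omega
    intro k
    induction k with
    | zero => simp
    | succ k ih =>
      intro hk
      obtain ⟨s, hs'⟩ : ∃ s, s₀ = s + 1 + k := ⟨s₀ - (k + 1), by omega⟩
      have ih' := ih (by omega)
      rw [show s₀ - k = s + 1 by omega] at ih'
      rw [show s₀ - (k + 1) = s by omega, Finset.sum_eq_sum_Ico_succ_bot (by omega)]
      obtain ⟨h1, h2⟩ := backward_stable hν hd (hlow s (by omega))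
      have hβ : 0 < ((d : ℝ) - s) * (d - s + 1 - ν) := lt_of_lt_of_le (by positivity) h1
      rw [mul_add, add_left_comm, add_comm]
      refine le_trans ?_ (add_le_add_left ih' _)
      refine le_of_mul_le_mul_left ?_ hβ
      calc ((d : ℝ) - s) * (d - s + 1 - ν) * |X s|
          = |((s : ℝ) + 1) * (s + ν) * X (s + 1) + h s| := by
            rw [hX s (by omega), sub_add_cancel, abs_mul, abs_of_pos hβ]
        _ ≤ |((s : ℝ) + 1) * (s + ν)| * |X (s + 1)| + |h s| := by
            rw [← abs_mul]; exact abs_add_le _ _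
        _ ≤ ((d : ℝ) - s) * (d - s + 1 - ν) * |X (s + 1)|
            + ((d : ℝ) - s) * (d - s + 1 - ν) * (16 / (d : ℝ) ^ 2 * |h s|) := by
            rw [abs_of_pos (by positivity : 0 < ((s : ℝ) + 1) * (s + ν))]
            gcongr
            exact hinv _ _ h2 (abs_nonneg _)
        _ = _ := by ring

/-- The homogeneous solution is nonnegative except for indices `s` close to `d`,
where it is negligible compared with its value at the pivot. -/
theorem neg_le_homWeight (hν : 0 < ν) (hd : 4 * ν ≤ d)
    (hlow : ∀ s < s₀, 2 * (s : ℝ) ≤ d - ν) (hup : ∀ s, s₀ ≤ s → (d : ℝ) - ν ≤ 2 * s)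
    (hs₀ : s₀ ≤ d) (hW : 0 < homWeight ν d s₀) {s : ℕ} (hs : s ≤ d) :
    -(16 * ν ^ 2 / (d : ℝ) ^ 2 * homWeight ν d s₀) ≤ homWeight ν d s := by
  have hd0 : (0 : ℝ) < d := by linarith
  rcases s with _ | s
  · rw [homWeight_zero]
    have : 0 ≤ 16 * ν ^ 2 / (d : ℝ) ^ 2 * homWeight ν d s₀ := by positivity
    linarith
  have hsd : (s : ℝ) + 1 ≤ d := by exact_mod_cast hs
  by_cases hβ : 0 ≤ (d : ℝ) - s + 1 - ν
  · have : 0 ≤ homWeight ν d (s + 1) := by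
      refine Finset.prod_nonneg fun t ht => ?_
      have hts : (t : ℝ) ≤ s := by
        exact_mod_cast Nat.lt_succ_iff.mp (Finset.mem_range.mp ht)
      exact div_nonneg (mul_nonneg (by linarith) (by linarith)) (by positivity)
    have : 0 ≤ 16 * ν ^ 2 / (d : ℝ) ^ 2 * homWeight ν d s₀ := by positivity
    linarith
  · push Not at hβ
    have hss : s₀ ≤ s := by
      by_contra hlt
      have := hlow s (by omega)
      linarith
    obtain ⟨-, hα⟩ := forward_stable hν hd (hup s hss) (by omega)
    have hw := homWeight_succ hν d s
    have hb := abs_le_of_pivot hν hd (X := homWeight ν d) (h := fun _ => 0) hlow hup hs₀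
      (fun t _ => by rw [homWeight_succ hν, sub_zero]) (s := s) (by omega)
    simp only [abs_zero, Finset.sum_const_zero, mul_zero, add_zero] at hb
    rw [abs_of_pos hW] at hb
    refine (abs_le.mp ?_).1
    have hαpos : 0 < ((s : ℝ) + 1) * (s + ν) := by positivity
    have hβ' : |((d : ℝ) - s) * (d - s + 1 - ν)| ≤ ν ^ 2 := by
      rw [abs_mul, abs_of_nonneg (by linarith), abs_of_neg hβ, sq]
      exact mul_le_mul (by linarith) (by linarith) (by linarith) hν.le
    refine le_of_mul_le_mul_left ?_ hαpos
    calc ((s : ℝ) + 1) * (s + ν) * |homWeight ν d (s + 1)|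
        = |((d : ℝ) - s) * (d - s + 1 - ν)| * |homWeight ν d s| := by
          rw [← abs_mul, ← hw, abs_mul, abs_of_pos hαpos]
      _ ≤ ν ^ 2 * homWeight ν d s₀ := by gcongr
      _ = (d : ℝ) ^ 2 / 16 * (16 * ν ^ 2 / (d : ℝ) ^ 2 * homWeight ν d s₀) := by field_simp
      _ ≤ _ := by gcongr

end

/-- In high degree the two-point problem is solved with a gain of one power of the degree in the
dependence on the source term. -/
theorem sum_abs_le_of_degree_solution {ν : ℝ} (hν : 0 < ν) {d : ℕ} (hd : 4 * ν ≤ d)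
    (hd' : 128 * ν ^ 2 ≤ d) {B h : ℕ → ℝ}
    (hB : ∀ s < d, ((s : ℝ) + 1) * (s + ν) * B (s + 1) =
        ((d : ℝ) - s) * (d - s + 1 - ν) * B s - h s) :
    ∑ s ∈ Finset.range (d + 1), |B s| ≤
      2 * |∑ s ∈ Finset.range (d + 1), B s| + 96 / d * ∑ s ∈ Finset.range d, |h s| := by
  have hd0 : (0 : ℝ) < d := by linarith
  have hd1 : (1 : ℝ) ≤ d := by exact_mod_cast Nat.one_le_iff_ne_zero.mpr (by rintro rfl; simp at hd0)
  set s₀ := ⌈((d : ℝ) - ν) / 2⌉₊ with hs₀def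
  have hlow : ∀ s < s₀, 2 * (s : ℝ) ≤ d - ν := fun s hs => by
    have := Nat.lt_ceil.mp hs
    linarith
  have hup : ∀ s, s₀ ≤ s → (d : ℝ) - ν ≤ 2 * s := fun s hs => by
    have := Nat.ceil_le.mp hs
    linarith
  have hs₀ : s₀ ≤ d := Nat.ceil_le.mpr (by linarith)
  set w := homWeight ν d with hw
  have hW : 0 < w s₀ := by
    refine Finset.prod_pos fun t ht => ?_
    have h1 := hlow t (Finset.mem_range.mp ht)
    have h2 : 0 < (d : ℝ) - t := by linarith
    have h3 : 0 < (d : ℝ) - t + 1 - ν := by linarith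
    positivity
  set W := w s₀
  set b := ∑ s ∈ Finset.range (d + 1), B s
  set H := ∑ s ∈ Finset.range d, |h s|
  have hH : 0 ≤ H := Finset.sum_nonneg fun _ _ => abs_nonneg _
  set η := 16 / (d : ℝ) ^ 2 * H
  set y := B s₀ / W
  set e : ℕ → ℝ := fun s => B s - y * w s with he
  have hη : ∀ s ∈ Finset.range (d + 1), |e s| ≤ η := by
    intro s hs
    have h1 := abs_le_of_pivot hν hd (X := e) (h := h) hlow hup hs₀ (fun t ht => by
      have h2 := homWeight_succ hν d t
      simp only [he, hw]
      linear_combination hB t ht - y * h2) (s := s) (by simpa [Nat.lt_succ_iff] using hs)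
    have h2 : e s₀ = 0 := by simp only [he, y]; field_simp; simp [W]
    rwa [h2, abs_zero, zero_add] at h1
  have hEsum : ∑ s ∈ Finset.range (d + 1), |e s| ≤ (d + 1) * η := by
    have := Finset.sum_le_card_nsmul _ _ _ hη
    rw [Finset.card_range, nsmul_eq_mul] at this
    exact_mod_cast this
  -- the negative weights contribute at most a quarter of the pivot weight
  have hwsum : ∑ s ∈ Finset.range (d + 1), |w s| ≤ 2 * ∑ s ∈ Finset.range (d + 1), w s := by
    have h1 : ∀ s ∈ Finset.range (d + 1),
        |w s| - w s ≤ 2 * (16 * ν ^ 2 / (d : ℝ) ^ 2 * W) := by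
      intro s hs
      have h2 : -(16 * ν ^ 2 / (d : ℝ) ^ 2 * W) ≤ w s :=
        neg_le_homWeight hν hd hlow hup hs₀ hW (by simpa [Nat.lt_succ_iff] using hs)
      have h3 : 0 ≤ 16 * ν ^ 2 / (d : ℝ) ^ 2 * W := by positivity
      rcases abs_cases (w s) with ⟨h4, _⟩ | ⟨h4, _⟩ <;> rw [h4] <;> linarith
    have h2 := Finset.sum_le_card_nsmul _ _ _ h1
    rw [Finset.card_range, nsmul_eq_mul, Finset.sum_sub_distrib] at h2
    have h3 : ((d + 1 : ℕ) : ℝ) * (2 * (16 * ν ^ 2 / (d : ℝ) ^ 2 * W)) ≤ W / 2 := by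
      push_cast
      rw [show ((d : ℝ) + 1) * (2 * (16 * ν ^ 2 / (d : ℝ) ^ 2 * W)) =
        (d + 1) * (32 * ν ^ 2) / (d : ℝ) ^ 2 * W by ring,
        show W / 2 = 1 / 2 * W by ring]
      refine mul_le_mul_of_nonneg_right ?_ hW.le
      rw [div_le_iff₀ (by positivity)]
      nlinarith [sq_nonneg ν]
    have h4 : W ≤ ∑ s ∈ Finset.range (d + 1), |w s| := (le_abs_self W).trans
      (Finset.single_le_sum (f := fun s => |w s|) (fun _ _ => abs_nonneg _)
        (Finset.mem_range.mpr (by omega)))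
    linarith
  have hyw : |y| * ∑ s ∈ Finset.range (d + 1), |w s| ≤ 2 * (|b| + (d + 1) * η) := by
    have h1 : y * ∑ s ∈ Finset.range (d + 1), w s = b - ∑ s ∈ Finset.range (d + 1), e s := by
      simp only [he, Finset.sum_sub_distrib, ← Finset.mul_sum]
      ring
    have h2 : |∑ s ∈ Finset.range (d + 1), e s| ≤ (d + 1) * η :=
      (Finset.abs_sum_le_sum_abs _ _).trans hEsum
    calc |y| * ∑ s ∈ Finset.range (d + 1), |w s|
        ≤ |y| * (2 * |∑ s ∈ Finset.range (d + 1), w s|) := by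
          gcongr
          exact hwsum.trans (by gcongr; exact le_abs_self _)
      _ = 2 * |y * ∑ s ∈ Finset.range (d + 1), w s| := by rw [abs_mul]; ring
      _ ≤ _ := by
          rw [h1]
          gcongr
          exact (abs_sub _ _).trans (by gcongr)
  calc ∑ s ∈ Finset.range (d + 1), |B s|
      ≤ ∑ s ∈ Finset.range (d + 1), (|y| * |w s| + |e s|) := by
        refine Finset.sum_le_sum fun s _ => ?_
        rw [← abs_mul]
        calc |B s| = |y * w s + e s| := by simp [he]
          _ ≤ _ := abs_add_le _ _
    _ = |y| * ∑ s ∈ Finset.range (d + 1), |w s| + ∑ s ∈ Finset.range (d + 1), |e s| := by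
        rw [Finset.sum_add_distrib, Finset.mul_sum]
    _ ≤ 2 * (|b| + (d + 1) * η) + (d + 1) * η := add_le_add hyw hEsum
    _ = 2 * |b| + 48 * (d + 1) / (d : ℝ) ^ 2 * H := by simp only [η]; ring
    _ ≤ _ := by
        refine add_le_add_right (mul_le_mul_of_nonneg_right ?_ hH) _
        rw [div_le_div_iff₀ (by positivity) hd0]
        nlinarith

/-! ### Construction and convergence of the even solution -/

theorem exists_forall_degree_solution {ν : ℝ} (hν : 0 < ν) (μ b : ℕ → ℝ) :
    ∃ B : ℕ → ℕ → ℝ, (∀ d s : ℕ, s < d → ((s : ℝ) + 1) * (s + ν) * B d (s + 1) =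
        ((d : ℝ) - s) * (d - s + 1 - ν) * B d s
          - 1 / 4 * ∑ m ∈ Finset.range (s + 1), μ m * B (d - 1 - m) (s - m)) ∧
      ∀ d, ∑ s ∈ Finset.range (d + 1), B d s = b d := by
  choose sol hrec hsum using fun (d : ℕ) (h : ℕ → ℝ) (b : ℝ) => exists_degree_solution hν d h b
  let F : ∀ d : ℕ, (∀ e, e < d → ℕ → ℝ) → ℕ → ℝ := fun d B =>
    sol d (fun s => 1 / 4 * ∑ m : Fin d, if m.val ≤ s then
      μ m * B (d - 1 - m) (by have := m.2; omega) (s - m) else 0) (b d)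
  let B : ℕ → ℕ → ℝ := WellFounded.fix (wellFounded_lt (α := ℕ)) F
  have hB : ∀ d, B d = sol d (fun s => 1 / 4 * ∑ m : Fin d, if m.val ≤ s then
      μ m * B (d - 1 - m) (s - m) else 0) (b d) := fun d => WellFounded.fix_eq _ F d
  refine ⟨B, fun d s hs => ?_, fun d => ?_⟩
  · have h1 := hrec d (fun s => 1 / 4 * ∑ m : Fin d, if m.val ≤ s then
      μ m * B (d - 1 - m) (s - m) else 0) (b d) s
    rw [← hB d] at h1
    rw [h1, Fin.sum_univ_eq_sum_range
      (fun m => if m ≤ s then μ m * B (d - 1 - m) (s - m) else 0) d]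
    congr 2
    rw [← Finset.sum_filter]
    congr 1
    ext m
    simp only [Finset.mem_filter, Finset.mem_range]
    omega
  · rw [hB d]
    exact hsum d _ _

/-- A sequence governed by a convolution recursion with a gain of `1 / d` has generating function
converging wherever those of the data converge. -/
theorem summable_of_convolution_bound {M μ b : ℕ → ℝ} {x K : ℝ} {e₀ : ℕ} (hx : 0 < x) (hK : 0 ≤ K)
    (hM0 : ∀ d, 0 ≤ M d) (hμ0 : ∀ d, 0 ≤ μ d) (hb0 : ∀ d, 0 ≤ b d)
    (hμ : Summable fun m => μ m * x ^ m) (hb : Summable fun d => b d * x ^ d)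
    (hM : ∀ e ≥ e₀, M (e + 1) ≤ b (e + 1)
      + K / (e + 1) * ∑ m ∈ Finset.range (e + 1), μ m * M (e - m)) :
    Summable fun d => M d * x ^ d := by
  set A := ∑' m, μ m * x ^ m with hA
  have hA0 : 0 ≤ A := tsum_nonneg fun m => mul_nonneg (hμ0 m) (by positivity)
  -- from degree `D` on, the convolution operator is a contraction with factor `1/2`
  obtain ⟨D, hDe₀, hD⟩ : ∃ D : ℕ, e₀ ≤ D ∧ K * x * A ≤ 1 / 2 * (D + 1) := by
    obtain ⟨D, hD⟩ := exists_nat_ge (2 * (K * x * A))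
    refine ⟨max e₀ D, le_max_left _ _, ?_⟩
    have : (D : ℝ) ≤ (max e₀ D : ℕ) := by exact_mod_cast le_max_right _ _
    linarith
  set θ := K * x / (D + 1) with hθ
  have hθ0 : 0 ≤ θ := by positivity
  have hθA : θ * A ≤ 1 / 2 := by
    rw [hθ, div_mul_eq_mul_div, div_le_iff₀ (by positivity)]
    exact hD
  set T : ℕ → ℝ := fun n => ∑ d ∈ Finset.range n, M d * x ^ d with hT
  have hT0 : ∀ d, 0 ≤ M d * x ^ d := fun d => mul_nonneg (hM0 d) (by positivity)
  set P : ℕ → ℝ := fun e => if e < D then M (e + 1) * x ^ (e + 1) else 0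
  have hP0 : ∀ e, 0 ≤ P e := fun e => by
    simp only [P]
    split_ifs
    · exact hT0 _
    · rfl
  have hconv0 : ∀ e, 0 ≤ ∑ m ∈ Finset.range (e + 1),
      (μ m * x ^ m) * (M (e - m) * x ^ (e - m)) := fun e =>
    Finset.sum_nonneg fun m _ => mul_nonneg (mul_nonneg (hμ0 m) (by positivity)) (hT0 _)
  have hstep : ∀ e, M (e + 1) * x ^ (e + 1) ≤ P e + b (e + 1) * x ^ (e + 1)
      + θ * ∑ m ∈ Finset.range (e + 1), (μ m * x ^ m) * (M (e - m) * x ^ (e - m)) := by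
    intro e
    have hbe : 0 ≤ b (e + 1) * x ^ (e + 1) := mul_nonneg (hb0 _) (by positivity)
    by_cases he : e < D
    · have h1 : P e = M (e + 1) * x ^ (e + 1) := if_pos he
      have h2 := mul_nonneg hθ0 (hconv0 e)
      linarith
    · have h1 : P e = 0 := if_neg he
      rw [h1, zero_add]
      have he' : (D : ℝ) ≤ e := by exact_mod_cast not_lt.mp he
      have h3 : x ^ e * ∑ m ∈ Finset.range (e + 1), μ m * M (e - m) =
          ∑ m ∈ Finset.range (e + 1), (μ m * x ^ m) * (M (e - m) * x ^ (e - m)) := by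
        rw [Finset.mul_sum]
        refine Finset.sum_congr rfl fun m hm => ?_
        have : e = m + (e - m) := by have := Finset.mem_range.mp hm; omega
        conv_lhs => rw [show x ^ e = x ^ m * x ^ (e - m) by rw [← pow_add, ← this]]
        ring
      calc M (e + 1) * x ^ (e + 1)
          ≤ (b (e + 1) + K / (e + 1) * ∑ m ∈ Finset.range (e + 1), μ m * M (e - m))
              * x ^ (e + 1) := by
            gcongr
            exact hM e (by omega)
        _ = b (e + 1) * x ^ (e + 1) + K * x / (e + 1) *
              (x ^ e * ∑ m ∈ Finset.range (e + 1), μ m * M (e - m)) := by ring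
        _ ≤ _ := by
            rw [h3, hθ]
            gcongr
            exact hconv0 e
  have hconv : ∀ n, ∑ e ∈ Finset.range n, ∑ m ∈ Finset.range (e + 1),
      (μ m * x ^ m) * (M (e - m) * x ^ (e - m)) ≤ A * T n := by
    intro n
    rw [Finset.sum_range_diag_flip n fun m k => (μ m * x ^ m) * (M k * x ^ k)]
    calc ∑ m ∈ Finset.range n, ∑ k ∈ Finset.range (n - m), μ m * x ^ m * (M k * x ^ k)
        ≤ ∑ m ∈ Finset.range n, (μ m * x ^ m) * T n := by
          refine Finset.sum_le_sum fun m _ => ?_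
          rw [← Finset.mul_sum]
          refine mul_le_mul_of_nonneg_left ?_ (mul_nonneg (hμ0 m) (by positivity))
          exact Finset.sum_le_sum_of_subset_of_nonneg
            (Finset.range_subset_range.mpr (Nat.sub_le _ _)) fun d _ _ => hT0 d
      _ ≤ A * T n := by
          rw [← Finset.sum_mul]
          refine mul_le_mul_of_nonneg_right ?_ (Finset.sum_nonneg fun d _ => hT0 d)
          exact hμ.sum_le_tsum _ fun m _ => mul_nonneg (hμ0 m) (by positivity)
  have hPsum : ∀ n, ∑ e ∈ Finset.range n, P e ≤ ∑ e ∈ Finset.range D, P e := by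
    intro n
    rcases le_total n D with h | h
    · exact Finset.sum_le_sum_of_subset_of_nonneg (Finset.range_subset_range.mpr h)
        fun e _ _ => hP0 e
    · refine (Finset.sum_subset (Finset.range_subset_range.mpr h) fun e _ he => ?_).ge
      exact if_neg fun h => he (Finset.mem_range.mpr h)
  have hbsum : ∀ n, ∑ e ∈ Finset.range n, b (e + 1) * x ^ (e + 1) ≤
      ∑' d, b (d + 1) * x ^ (d + 1) := fun n =>
    ((summable_nat_add_iff 1).mpr hb).sum_le_tsum _ fun d _ => mul_nonneg (hb0 _) (by positivity)
  set Q := M 0 + ∑ e ∈ Finset.range D, P e + ∑' d, b (d + 1) * x ^ (d + 1)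
  refine summable_of_sum_range_le (c := 2 * Q) hT0 fun n => ?_
  have h1 : T n ≤ T (n + 1) := by
    simp only [hT, Finset.sum_range_succ]
    linarith [hT0 n]
  have h2 : T (n + 1) ≤ Q + 1 / 2 * T n := by
    calc T (n + 1) = ∑ e ∈ Finset.range n, M (e + 1) * x ^ (e + 1) + M 0 := by
          simp only [hT, Finset.sum_range_succ', pow_zero, mul_one]
      _ ≤ ∑ e ∈ Finset.range n, (P e + b (e + 1) * x ^ (e + 1)
          + θ * ∑ m ∈ Finset.range (e + 1), (μ m * x ^ m) * (M (e - m) * x ^ (e - m))) + M 0 := by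
          gcongr with e _
          exact hstep e
      _ = ∑ e ∈ Finset.range n, P e + ∑ e ∈ Finset.range n, b (e + 1) * x ^ (e + 1)
          + θ * ∑ e ∈ Finset.range n, ∑ m ∈ Finset.range (e + 1),
            (μ m * x ^ m) * (M (e - m) * x ^ (e - m)) + M 0 := by
          rw [Finset.sum_add_distrib, Finset.sum_add_distrib, ← Finset.mul_sum]
      _ ≤ ∑ e ∈ Finset.range D, P e + ∑' d, b (d + 1) * x ^ (d + 1) + θ * (A * T n) + M 0 := by
          have h3 := mul_le_mul_of_nonneg_left (hconv n) hθ0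
          linarith [hPsum n, hbsum n]
      _ ≤ ∑ e ∈ Finset.range D, P e + ∑' d, b (d + 1) * x ^ (d + 1) + 1 / 2 * T n + M 0 := by
          rw [← mul_assoc θ]
          gcongr
          exact Finset.sum_nonneg fun d _ => hT0 d
      _ = _ := by simp only [Q]; ring
  change T n ≤ 2 * Q
  linarith

theorem summable_sum_abs_mul_pow {ν : ℝ} (hν : 0 < ν) {μ b : ℕ → ℝ} {B : ℕ → ℕ → ℝ}
    (hrec : ∀ d s : ℕ, s < d → ((s : ℝ) + 1) * (s + ν) * B d (s + 1) =
        ((d : ℝ) - s) * (d - s + 1 - ν) * B d s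
          - 1 / 4 * ∑ m ∈ Finset.range (s + 1), μ m * B (d - 1 - m) (s - m))
    (hsum : ∀ d, ∑ s ∈ Finset.range (d + 1), B d s = b d) {x : ℝ} (hx : 0 < x)
    (hμ : Summable fun m => |μ m| * x ^ m) (hb : Summable fun d => |b d| * x ^ d) :
    Summable fun d => (∑ s ∈ Finset.range (d + 1), |B d s|) * x ^ d := by
  obtain ⟨e₀, he₀⟩ := exists_nat_ge (max (4 * ν) (128 * ν ^ 2))
  refine summable_of_convolution_bound (μ := fun m => |μ m|) (b := fun d => 2 * |b d|) (K := 24)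
    (e₀ := e₀) hx (by norm_num) (fun d => Finset.sum_nonneg fun _ _ => abs_nonneg _)
    (fun m => abs_nonneg _) (fun d => by positivity) hμ
    ((hb.mul_left 2).congr fun d => by ring) fun e he => ?_
  have hed : max (4 * ν) (128 * ν ^ 2) ≤ ((e + 1 : ℕ) : ℝ) :=
    he₀.trans (by exact_mod_cast (by omega : e₀ ≤ e + 1))
  have h1 := sum_abs_le_of_degree_solution hν ((le_max_left _ _).trans hed)
    ((le_max_right _ _).trans hed) (fun s hs => hrec (e + 1) s hs)
  rw [hsum] at h1
  refine h1.trans (add_le_add_right ?_ _)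
  calc 96 / ((e + 1 : ℕ) : ℝ) * ∑ s ∈ Finset.range (e + 1),
        |1 / 4 * ∑ m ∈ Finset.range (s + 1), μ m * B (e + 1 - 1 - m) (s - m)|
      ≤ 96 / ((e + 1 : ℕ) : ℝ) * ∑ s ∈ Finset.range (e + 1),
        1 / 4 * ∑ m ∈ Finset.range (s + 1), |μ m| * |B (e - m) (s - m)| := by
        gcongr with s _
        rw [abs_mul, abs_of_pos (by norm_num : (0 : ℝ) < 1 / 4)]
        gcongr
        refine (Finset.abs_sum_le_sum_abs _ _).trans_eq ?_
        simp only [abs_mul, Nat.add_sub_cancel]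
    _ = 24 / ((e : ℝ) + 1) * ∑ s ∈ Finset.range (e + 1), ∑ m ∈ Finset.range (s + 1),
        |μ m| * |B (e - m) (s - m)| := by
        rw [← Finset.mul_sum]
        push_cast
        ring
    _ = _ := by
        rw [Finset.sum_range_diag_flip (e + 1) fun m k => |μ m| * |B (e - m) k|]
        congr 1
        refine Finset.sum_congr rfl fun m hm => ?_
        rw [Finset.mul_sum, show e + 1 - m = e - m + 1 by
          have := Finset.mem_range.mp hm; omega]

/-- The double sequence supported on even exponents whose part of total degree `2d` is
`∑ B d s r^(2d-2s) ρ^(2s)`. -/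
def evenCoeffs (B : ℕ → ℕ → ℝ) (j k : ℕ) : ℝ :=
  if Even j ∧ Even k then B ((j + k) / 2) (k / 2) else 0

theorem evenCoeffs_two_mul (B : ℕ → ℕ → ℝ) (p q : ℕ) :
    evenCoeffs B (2 * p) (2 * q) = B (p + q) q := by
  rw [evenCoeffs, if_pos ⟨even_two_mul p, even_two_mul q⟩, ← mul_add,
    Nat.mul_div_cancel_left _ two_pos, Nat.mul_div_cancel_left _ two_pos]

theorem evenCoeffs_of_odd_fst (B : ℕ → ℕ → ℝ) {j : ℕ} (hj : Odd j) (k : ℕ) :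
    evenCoeffs B j k = 0 :=
  if_neg fun h => Nat.not_even_iff_odd.mpr hj h.1

theorem evenCoeffs_of_odd_snd (B : ℕ → ℕ → ℝ) (j : ℕ) {k : ℕ} (hk : Odd k) :
    evenCoeffs B j k = 0 :=
  if_neg fun h => Nat.not_even_iff_odd.mpr hk h.2

theorem absConv_evenCoeffs {B : ℕ → ℕ → ℝ} {a : ℝ} (ha : 0 ≤ a)
    (h : Summable fun d => (∑ s ∈ Finset.range (d + 1), |B d s|) * (a ^ 2) ^ d) :
    AbsConv (evenCoeffs B) a := by
  have hinj : Function.Injective fun q : ℕ × ℕ => (2 * q.1, 2 * q.2) := by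
    rintro ⟨p, q⟩ ⟨p', q'⟩ h
    simp only [Prod.mk.injEq] at h
    ext <;> simp <;> omega
  refine (hinj.summable_iff fun q hq => ?_).mp ?_
  · have : ¬ (Even q.1 ∧ Even q.2) := by
      rintro ⟨h1, h2⟩
      exact hq ⟨(q.1 / 2, q.2 / 2), by
        simp [Nat.mul_div_cancel' h1.two_dvd, Nat.mul_div_cancel' h2.two_dvd]⟩
    simp [evenCoeffs, this]
  · rw [← (Finset.HasAntidiagonal.sigmaAntidiagonalEquivProd (A := ℕ)).summable_iff]
    refine (summable_sigma_of_nonneg fun q => ?_).mpr ⟨fun d => Summable.of_finite, ?_⟩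
    · simp only [Function.comp]
      positivity
    · refine h.congr fun d => ?_
      rw [tsum_fintype]
      have h1 := Finset.sum_coe_sort (antidiagonal d) (fun q : ℕ × ℕ =>
        |B d q.2| * (a ^ 2) ^ d)
      rw [Finset.sum_mul, ← Finset.Nat.sum_antidiagonal_eq_sum_range_succ_mk
        (f := fun q : ℕ × ℕ => |B d q.1| * (a ^ 2) ^ d), ← Finset.Nat.sum_antidiagonal_swap]
      refine h1.symm.trans (Finset.sum_congr rfl fun q _ => ?_)
      have hq := mem_antidiagonal.mp q.2
      simp only [Function.comp, Finset.HasAntidiagonal.sigmaAntidiagonalEquivProd_apply,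
        evenCoeffs_two_mul]
      rw [hq, mul_assoc, ← pow_add, ← mul_add, hq, pow_mul]

theorem convCoeff_evenCoeffs {μ : ℕ → ℝ} (hμ : ∀ m, Odd m → μ m = 0) (B : ℕ → ℕ → ℝ) (p q : ℕ) :
    convCoeff μ (evenCoeffs B) (2 * p) (2 * q) =
      ∑ m ∈ Finset.range (q + 1), μ (2 * m) * B (p + q - m) (q - m) := by
  rw [convCoeff, Finset.Nat.sum_antidiagonal_eq_sum_range_succ_mk,
    sum_range_eq_sum_even (f := fun m => μ m * evenCoeffs B (2 * p) (2 * q - m))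
      fun m hm => by rw [hμ m hm, zero_mul],
    Nat.mul_div_cancel_left _ two_pos]
  refine Finset.sum_congr rfl fun m hm => ?_
  have := Finset.mem_range.mp hm
  rw [← Nat.mul_sub, evenCoeffs_two_mul, ← Nat.add_sub_assoc (by omega)]

theorem convCoeff_evenCoeffs_of_odd {μ : ℕ → ℝ} (hμ : ∀ m, Odd m → μ m = 0) (B : ℕ → ℕ → ℝ)
    {j k : ℕ} (h : Odd j ∨ Odd k) : convCoeff μ (evenCoeffs B) j k = 0 := by
  refine Finset.sum_eq_zero fun q hq => ?_
  rcases h with h | h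
  · rw [evenCoeffs_of_odd_fst B h, mul_zero]
  · rw [← mem_antidiagonal.mp hq, Nat.odd_add] at h
    rcases Nat.even_or_odd q.1 with h1 | h1
    · rw [evenCoeffs_of_odd_snd B j, mul_zero]
      rw [← Nat.not_even_iff_odd] at h ⊢
      exact fun h2 => (h.mpr h2) h1
    · rw [hμ _ h1, zero_mul]

theorem isFormalSolution_evenCoeffs {ν : ℝ} {μ : ℕ → ℝ} (hμ : ∀ m, Odd m → μ m = 0)
    {B : ℕ → ℕ → ℝ}
    (hrec : ∀ d s : ℕ, s < d → ((s : ℝ) + 1) * (s + ν) * B d (s + 1) =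
        ((d : ℝ) - s) * (d - s + 1 - ν) * B d s
          - 1 / 4 * ∑ m ∈ Finset.range (s + 1), μ (2 * m) * B (d - 1 - m) (s - m))
    (hsum : ∀ d : ℕ, ∑ s ∈ Finset.range (d + 1), B d s =
      -(μ (2 * d) / (2 * ((2 * d : ℕ) + 1)))) :
    IsFormalSolution (2 * ν) μ (evenCoeffs B) := by
  constructor
  · rw [kernelResidual_eq_zero_iff]
    refine ⟨fun j k => ?_, fun k => ?_, fun j => ?_⟩
    · rcases Nat.even_or_odd' j with ⟨p, rfl | rfl⟩
      · rcases Nat.even_or_odd' k with ⟨q, rfl | rfl⟩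
        · rw [convCoeff_evenCoeffs hμ, show 2 * p + 2 = 2 * (p + 1) by ring,
            show 2 * q + 2 = 2 * (q + 1) by ring, evenCoeffs_two_mul, evenCoeffs_two_mul]
          have h := hrec (p + q + 1) q (by omega)
          rw [show p + q + 1 - 1 = p + q by omega] at h
          rw [show p + 1 + q = p + q + 1 by ring, show p + (q + 1) = p + q + 1 by ring]
          push_cast at h ⊢
          linear_combination (-4) * h
        · have h2 : Odd (2 * q + 1 + 2) := ⟨q + 1, by ring⟩
          rw [convCoeff_evenCoeffs_of_odd hμ B (Or.inr ⟨q, rfl⟩), evenCoeffs_of_odd_snd B _ ⟨q, rfl⟩,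
            evenCoeffs_of_odd_snd B _ h2]
          ring
      · have h2 : Odd (2 * p + 1 + 2) := ⟨p + 1, by ring⟩
        rw [convCoeff_evenCoeffs_of_odd hμ B (Or.inl ⟨p, rfl⟩), evenCoeffs_of_odd_fst B ⟨p, rfl⟩,
          evenCoeffs_of_odd_fst B h2]
        ring
    · rw [evenCoeffs_of_odd_fst B odd_one, mul_zero]
    · rw [evenCoeffs_of_odd_snd B _ odd_one, mul_zero]
  · intro i
    rcases Nat.even_or_odd' i with ⟨d, rfl | rfl⟩
    · rw [← Finset.Nat.sum_antidiagonal_swap, Finset.Nat.sum_antidiagonal_eq_sum_range_succ_mk,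
        ← hsum]
      refine (sum_range_eq_sum_even (f := fun k => evenCoeffs B (2 * d - k) k)
        (fun k hk => evenCoeffs_of_odd_snd B _ hk) (2 * d)).trans ?_
      rw [Nat.mul_div_cancel_left _ two_pos]
      refine Finset.sum_congr rfl fun s hs => ?_
      have := Finset.mem_range.mp hs
      rw [← Nat.mul_sub, evenCoeffs_two_mul, Nat.sub_add_cancel (by omega)]
    · rw [hμ _ ⟨d, rfl⟩, zero_div, neg_zero]
      refine Finset.sum_eq_zero fun q hq => ?_
      rcases Nat.even_or_odd q.1 with h1 | h1
      · refine evenCoeffs_of_odd_snd B _ ?_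
        have := mem_antidiagonal.mp hq
        obtain ⟨m, hm⟩ := h1
        exact ⟨d - m, by omega⟩
      · exact evenCoeffs_of_odd_fst B h1 _

theorem kernelSum_evenCoeffs_neg_fst (B : ℕ → ℕ → ℝ) (r ρ : ℝ) :
    kernelSum (evenCoeffs B) (-r) ρ = kernelSum (evenCoeffs B) r ρ := by
  refine tsum_congr fun q => ?_
  rcases Nat.even_or_odd q.1 with h | h
  · rw [h.neg_pow]
  · rw [evenCoeffs_of_odd_fst B h]
    ring

theorem kernelSum_evenCoeffs_neg_snd (B : ℕ → ℕ → ℝ) (r ρ : ℝ) :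
    kernelSum (evenCoeffs B) r (-ρ) = kernelSum (evenCoeffs B) r ρ := by
  refine tsum_congr fun q => ?_
  rcases Nat.even_or_odd q.2 with h | h
  · rw [h.neg_pow]
  · rw [evenCoeffs_of_odd_snd B _ h]
    ring

/-- For even data there is a formal solution with even exponents only, which converges
wherever the Maclaurin series of the data does. -/
theorem exists_even_formalSolution {N : ℝ} (hN : 0 < N) {μ : ℕ → ℝ}
    (hμ : ∀ m, Odd m → μ m = 0) :
    ∃ B : ℕ → ℕ → ℝ, IsFormalSolution N μ (evenCoeffs B) ∧
      ∀ a : ℝ, 0 < a → (Summable fun m => |μ m| * a ^ m) → AbsConv (evenCoeffs B) a := by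
  obtain ⟨B, hrec, hsum⟩ := exists_forall_degree_solution (half_pos hN) (fun m => μ (2 * m))
    fun d : ℕ => -(μ (2 * d) / (2 * ((2 * d : ℕ) + 1)))
  refine ⟨B, ?_, fun a ha hs => ?_⟩
  · have := isFormalSolution_evenCoeffs hμ hrec hsum
    rwa [mul_div_cancel₀ N two_ne_zero] at this
  · have hs' : Summable fun m => |μ (2 * m)| * (a ^ 2) ^ m :=
      (hs.comp_injective (mul_right_injective₀ (two_ne_zero (α := ℕ)))).congr fun m => by
        simp only [Function.comp, pow_mul]
    refine absConv_evenCoeffs ha.le (summable_sum_abs_mul_pow (half_pos hN) hrec hsum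
      (by positivity) hs' ?_)
    refine Summable.of_nonneg_of_le (fun d => by positivity) (fun d => ?_) hs'
    refine mul_le_mul_of_nonneg_right ?_ (by positivity)
    rw [abs_neg, abs_div]
    refine div_le_self (abs_nonneg _) ?_
    have : (0 : ℝ) ≤ ((2 * d : ℕ) : ℝ) := by positivity
    rw [abs_of_pos (by positivity)]
    linarith

/-! ### Maclaurin coefficients of the reaction term -/

/-- The Maclaurin coefficients of `(λ + c) / ε`. -/
noncomputable def reactionCoeff (p : FormalMultilinearSeries ℝ ℝ ℝ) (ε c : ℝ) (m : ℕ) : ℝ :=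
  (p.coeff m + if m = 0 then c else 0) / ε

section

variable {ε c : ℝ} {lam : ℝ → ℝ} {R : ENNReal} {p : FormalMultilinearSeries ℝ ℝ ℝ}

theorem hasSum_reactionCoeff (hlam : HasFPowerSeriesOnBall lam p 0 R) {x : ℝ}
    (hx : ENNReal.ofReal |x| < R) :
    HasSum (fun m => reactionCoeff p ε c m * x ^ m) ((lam x + c) / ε) := by
  have hmem : x ∈ Metric.eball (0 : ℝ) R := by
    rwa [mem_eball_zero_iff, ← ofReal_norm, Real.norm_eq_abs]
  have h1 := hlam.hasSum hmem
  rw [zero_add] at h1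
  have h2 := hasSum_ite_eq 0 c
  refine ((h1.add h2).div_const ε).of_eq (fun m => ?_) rfl
  rw [FormalMultilinearSeries.apply_eq_pow_smul_coeff, smul_eq_mul, reactionCoeff]
  split_ifs with hm
  · rw [hm, pow_zero]
    ring
  · ring

theorem exists_pos_ofReal_lt (hR : 0 < R) : ∃ a : ℝ, 0 < a ∧ ENNReal.ofReal a < R := by
  obtain ⟨a, -, h0, ha⟩ := ENNReal.lt_iff_exists_real_btwn.mp hR
  exact ⟨a, ENNReal.ofReal_pos.mp h0, ha⟩

theorem ofReal_abs_lt {a x : ℝ} (ha : ENNReal.ofReal a < R) (hx : |x| < a) :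
    ENNReal.ofReal |x| < R :=
  (ENNReal.ofReal_le_ofReal hx.le).trans_lt ha

theorem isEvenWithin_iff (hlam : HasFPowerSeriesOnBall lam p 0 R) (hε : ε ≠ 0) :
    IsEvenWithin R lam ↔ ∀ m, Odd m → reactionCoeff p ε c m = 0 := by
  constructor
  · intro hev m hm
    obtain ⟨a, ha0, haR⟩ := exists_pos_ofReal_lt hlam.r_pos
    have h := coeff_eq_zero_of_hasSum_zero ha0 m
      (c := fun m => reactionCoeff p ε c m * (1 - (-1) ^ m)) fun x hx hxa => by
        have hxR : ENNReal.ofReal |x| < R := ofReal_abs_lt haR (by rwa [abs_of_pos hx])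
        have h1 := hasSum_reactionCoeff (ε := ε) (c := c) hlam hxR
        have h2 := hasSum_reactionCoeff (ε := ε) (c := c) hlam (x := -x) (by rwa [abs_neg])
        rw [hev x hxR] at h2
        refine (h1.sub h2).of_eq (fun m => ?_) (sub_self _)
        rw [neg_pow x]
        ring
    rw [hm.neg_one_pow] at h
    linarith
  · intro hodd x hx
    have h1 := hasSum_reactionCoeff (ε := ε) (c := c) hlam hx
    have h2 := hasSum_reactionCoeff (ε := ε) (c := c) hlam (x := -x) (by rwa [abs_neg])
    have h3 : (lam (-x) + c) / ε = (lam x + c) / ε := by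
      refine h2.unique (h1.of_eq (fun m => ?_) rfl)
      rcases Nat.even_or_odd m with hm | hm
      · rw [hm.neg_pow]
      · rw [hodd m hm, zero_mul, zero_mul]
    rw [div_left_inj' hε] at h3
    linarith

end

theorem mainTheorem1 (n : ℕ) (hn : 1 < n) (ε c : ℝ) (hε : 0 < ε)
    (lam : ℝ → ℝ) (R : ENNReal) (p : FormalMultilinearSeries ℝ ℝ ℝ)
    (hlam : HasFPowerSeriesOnBall lam p 0 R) :
    (IsEvenWithin R lam → ∀ l : ℕ, ∃ C : ℕ → ℕ → ℝ,
      (∀ δ : ℝ, 0 < δ → ENNReal.ofReal δ < R →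
        IsPowerSeriesSolution n l ε c lam δ C ∧
        AnalyticOnNhd ℝ (fun x : ℝ × ℝ => kernelSum C x.1 x.2) (kernelTriangle δ) ∧
        (∀ r ρ : ℝ, |r| ≤ δ → |ρ| ≤ δ →
          kernelSum C (-r) ρ = kernelSum C r ρ ∧ kernelSum C r (-ρ) = kernelSum C r ρ)) ∧
      (∀ δ : ℝ, 0 < δ → ∀ C' : ℕ → ℕ → ℝ,
        IsPowerSeriesSolution n l ε c lam δ C' → C' = C)) ∧
    (¬ IsEvenWithin R lam → ∀ᶠ l : ℕ in atTop,
      ∀ δ : ℝ, 0 < δ → ¬ ∃ C : ℕ → ℕ → ℝ, IsPowerSeriesSolution n l ε c lam δ C) := by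
  have hcoeff : ∀ a : ℝ, ENNReal.ofReal a < R → ∀ x, |x| < a →
      HasSum (fun m => reactionCoeff p ε c m * x ^ m) ((lam x + c) / ε) :=
    fun a ha x hx => hasSum_reactionCoeff hlam (ofReal_abs_lt ha hx)
  obtain ⟨a₀, ha₀, ha₀R⟩ := exists_pos_ofReal_lt hlam.r_pos
  have hformal : ∀ (l : ℕ) (δ : ℝ), 0 < δ → ∀ C : ℕ → ℕ → ℝ,
      IsPowerSeriesSolution n l ε c lam δ C →
      IsFormalSolution (n + 2 * l) (reactionCoeff p ε c) C := fun l δ hδ C hC =>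
    hC.isFormalSolution hδ ha₀ hε.ne' (hcoeff a₀ ha₀R)
  constructor
  · intro hev l
    have hn0 : (0 : ℝ) < n := by exact_mod_cast (by omega : 0 < n)
    obtain ⟨B, hB, hconv⟩ := exists_even_formalSolution (N := n + 2 * l) (by positivity)
      ((isEvenWithin_iff (c := c) hlam hε.ne').mp hev)
    refine ⟨evenCoeffs B, fun δ hδ hδR => ?_, fun δ hδ C' hC' => hB.unique hn (hformal l δ hδ C' hC')⟩
    -- absolute convergence on a slightly larger square
    obtain ⟨a', -, hδa', ha'R⟩ := ENNReal.lt_iff_exists_real_btwn.mp hδR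
    have hδa'' : δ < a' := (ENNReal.ofReal_lt_ofReal_iff'.mp hδa').1
    obtain ⟨a, hδa, haa'⟩ := exists_between hδa''
    have ha : 0 < a := hδ.trans hδa
    have hC : AbsConv (evenCoeffs B) a :=
      hconv a ha (summable_abs_coeff ha.le haa' (hcoeff a' ha'R))
    have haR : ENNReal.ofReal a < R := (ENNReal.ofReal_le_ofReal haa'.le).trans_lt ha'R
    refine ⟨hB.isPowerSeriesSolution hδa hε.ne' hC (hcoeff a haR), ?_, fun r ρ _ _ =>
      ⟨kernelSum_evenCoeffs_neg_fst B r ρ, kernelSum_evenCoeffs_neg_snd B r ρ⟩⟩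
    refine (hC.analyticOnNhd ha).mono fun x hx => ?_
    obtain ⟨h1, h2, h3⟩ := hx
    rw [mem_ball_zero_iff, Prod.norm_def, max_lt_iff, Real.norm_eq_abs, Real.norm_eq_abs,
      abs_of_nonneg h1, abs_of_nonneg (h1.trans h2)]
    constructor <;> linarith
  · intro hev
    rw [isEvenWithin_iff (c := c) hlam hε.ne'] at hev
    push Not at hev
    classical
    -- `Nat.find hev` is the first odd index with a nonzero Maclaurin coefficient
    obtain ⟨hodd, hne⟩ := Nat.find_spec hev
    filter_upwards [eventually_gt_atTop (Nat.find hev)] with l hl δ hδ ⟨C, hC⟩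
    refine hne ((hformal l δ hδ C hC).odd_coeff_eq_zero hn hodd (by omega) fun m hm hmodd => ?_)
    by_contra h
    exact Nat.find_min hev hm ⟨hmodd, h⟩
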